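/- Let $n\ge 1$, $m\ge 0$ and $k=m+n-1$ be integers. A polyhedron in $\mathbb R^m$ is an intersection of finitely many closed half-spaces (possibly empty); it is a lattice polyhedron if all its vertices lie in $\mathbb Z^m$. For a convex cone $C\subset\mathbb R^m$, a nonempty polyhedron $\Delta$ is parallel to $C$ if, for every $a\in\mathbb R^m$, $a+\Delta\subseteq\Delta$ if and only if $a+C\subseteq C$. A bounded pair of lattice polyhedra in $BP_C$ is a pair $(\Gamma,\Delta)$ of lattice polyhedra, each of them parallel to $C$ or empty, such that $\Gamma\setminus\Delta$ and $\Delta\setminus\Gamma$ are bounded. Minkowski sums, convex hulls of unions (denoted by $\bigvee$) and the Cayley operation below are applied to pairs componentwise. For a bounded set $S$ let $I(S)=|S\cap\mathbb Z^m|$, and for a bounded pair let $I(\Gamma,\Delta)=I(\Gamma\setminus\Delta)-I(\Delta\setminus\Gamma)$ and $\mathrm{Vol}(\Gamma,\Delta)=\mathrm{Vol}(\Gamma\setminus\Delta)-\mathrm{Vol}(\Delta\setminus\Gamma)$. The Cayley polyhedron $\Delta_1*\dots*\Delta_n\subset\mathbb R^{n-1}\oplus\mathbb R^m=\mathbb R^k$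 is the convex hull of $\bigcup_i\{e_i\}\times\Delta_i$, where $e_1,\dots,e_{n-1}$ is the standard basis of $\mathbb R^{n-1}$ and $e_n=0$. The mixed volume $\mathrm{MV}$ of $k$ nonempty bounded polyhedra (or of $k$ bounded pairs of nonempty polyhedra) in $\mathbb R^k$ is the symmetric function, additive in each argument with respect to Minkowski summation, with $\mathrm{MV}(A,\dots,A)=\mathrm{Vol}(A)$; that is, $$\mathrm{MV}(A_1,\dots,A_k)=\frac1{k!}\sum_{J\subset\{1,\dots,k\}}(-1)^{k-|J|}\,\mathrm{Vol}\Bigl(\sum_{j\in J}A_j\Bigr).$$ Suppose that either all $B_{i,j}$, $i=1,\dots,n$, $j=1,\dots,k$, are bounded lattice polyhedra in $\mathbb R^m$, or all $B_{i,j}$ are bounded pairs of lattice polyhedra in $BP_C$ for one convex cone $C\subset\mathbb R^m$. Some of the polyhedra may be empty, but for each $j$ the Cayley polyhedron $B_{1,j}*\dots*B_{n,j}$ (for pairs, each of its two components) is nonempty. Then $$\mathrm{MV}\bigl(B_{1,1}*\dots*B_{n,1},\ \dots,\ B_{1,k}*\dots*B_{n,k}\bigr)=\frac1{k!}\sum_{J\subset\{1,\dots,k\}}\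 \sum_{b_1+\dots+b_n=|J|}(-1)^{k-|J|}\,I\Bigl(\bigvee_{J_1\sqcup\dots\sqcup J_n=J\atop |J_1|=b_1,\dots,|J_n|=b_n}\ \sum_{i=1,\dots,n\atop j\in J_i}B_{i,j}\Bigr).$$ Here $J$ runs over all subsets including $\varnothing$, the $b_i$ are non-negative integers, $\bigvee$ is taken over all decompositions of $J$ into disjoint sets $J_i$ of size $b_i$, and in both formulas the empty Minkowski sum is $\{0\}$ for polyhedra and $(\{0\},\{0\})$ for pairs. -/

import Mathlib

open scoped Pointwise

noncomputable section

/-- A polyhedron in `ℝ^m`: the intersection of finitely many closed half-spaces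
(the empty set included). -/
def IsPolyhedron {m : ℕ} (P : Set (Fin m → ℝ)) : Prop :=
  ∃ s : Finset (((Fin m → ℝ) →ₗ[ℝ] ℝ) × ℝ), P = {x | ∀ h ∈ s, h.1 x ≤ h.2}

/-- The integer lattice points of `ℝ^m`. -/
def latticePoints (m : ℕ) : Set (Fin m → ℝ) := {x | ∀ i, ∃ z : ℤ, x i = z}

/-- A lattice polyhedron: all its vertices are integer lattice points. -/
def IsLatticePolyhedron {m : ℕ} (P : Set (Fin m → ℝ)) : Prop :=
  IsPolyhedron P ∧ P.extremePoints ℝ ⊆ latticePoints m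

/-- Two sets are parallel if they are mapped into themselves by the same translations. -/
def Parallel {m : ℕ} (P Q : Set (Fin m → ℝ)) : Prop :=
  ∀ a : Fin m → ℝ, a +ᵥ P ⊆ P ↔ a +ᵥ Q ⊆ Q

/-- A bounded pair of lattice polyhedra parallel to the convex cone `C`: both differences are
bounded. The empty polyhedron is admitted as a component of a pair. -/
structure IsBoundedLatticePair {m : ℕ} (C : ConvexCone ℝ (Fin m → ℝ))
    (A : Set (Fin m → ℝ) × Set (Fin m → ℝ)) : Prop where
  lattice_fst : IsLatticePolyhedron A.1
  lattice_snd : IsLatticePolyhedron A.2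
  parallel_fst : A.1 = ∅ ∨ Parallel A.1 (C : Set (Fin m → ℝ))
  parallel_snd : A.2 = ∅ ∨ Parallel A.2 (C : Set (Fin m → ℝ))
  bounded_fst : Bornology.IsBounded (A.1 \ A.2)
  bounded_snd : Bornology.IsBounded (A.2 \ A.1)

/-- The number of integer lattice points of a bounded set. -/
def latticeCount {m : ℕ} (S : Set (Fin m → ℝ)) : ℕ := (S ∩ latticePoints m).ncard

/-- The signed number of integer lattice points of a bounded pair. -/
def pairLatticeCount {m : ℕ} (A : Set (Fin m → ℝ) × Set (Fin m → ℝ)) : ℤ :=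
  (latticeCount (A.1 \ A.2) : ℤ) - (latticeCount (A.2 \ A.1) : ℤ)

/-- The volume of a bounded pair. -/
def pairVolume {E : Type*} [MeasureTheory.MeasureSpace E] (A : Set E × Set E) : ℝ :=
  MeasureTheory.volume.real (A.1 \ A.2) - MeasureTheory.volume.real (A.2 \ A.1)

/-- The mixed volume of `k` nonempty bounded convex sets in a `k`-dimensional space `E`: the value
forced by polarization on the symmetric function, additive in each argument with respect to
Minkowski summation, whose diagonal values are the volumes. (The sum over `J = ∅` is `{0}`.) -/
def mixedVolume {E : Type*} [AddCommGroup E] [MeasureTheory.MeasureSpace E] {k : ℕ}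
    (A : Fin k → Set E) : ℝ :=
  (1 / (k.factorial : ℝ)) * ∑ J : Finset (Fin k),
    (-1 : ℝ) ^ (k - J.card) * MeasureTheory.volume.real (∑ j ∈ J, A j)

/-- The mixed volume of `k` bounded pairs in a `k`-dimensional space `E`: the value forced by
polarization on the symmetric function, additive in each argument with respect to componentwise
Minkowski summation, whose diagonal values are the volumes of pairs. (The sum over `J = ∅` is
the pair `({0}, {0})`, of volume zero.) -/
def pairMixedVolume {E : Type*} [AddCommGroup E] [MeasureTheory.MeasureSpace E] {k : ℕ}
    (A : Fin k → Set E × Set E) : ℝ :=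
  (1 / (k.factorial : ℝ)) * ∑ J : Finset (Fin k),
    (-1 : ℝ) ^ (k - J.card) * pairVolume (∑ j ∈ J, A j)

/-- The vertices of the standard simplex in `ℝ^(n-1)`: the unit vectors, followed by the origin. -/
def simplexVertex {n : ℕ} (i : Fin n) : Fin (n - 1) → ℝ :=
  fun l => if (l : ℕ) = (i : ℕ) then 1 else 0

/-- The Cayley polyhedron `Δ₁ * … * Δₙ` in `ℝ^(n-1) ⊕ ℝ^m`. -/
def cayley {n m : ℕ} (Δ : Fin n → Set (Fin m → ℝ)) : Set ((Fin (n - 1) → ℝ) × (Fin m → ℝ)) :=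
  convexHull ℝ (⋃ i, {simplexVertex i} ×ˢ Δ i)

/-- The Cayley pair `(Γ₁, Δ₁) * … * (Γₙ, Δₙ)`. -/
def pairCayley {n m : ℕ} (A : Fin n → Set (Fin m → ℝ) × Set (Fin m → ℝ)) :
    Set ((Fin (n - 1) → ℝ) × (Fin m → ℝ)) × Set ((Fin (n - 1) → ℝ) × (Fin m → ℝ)) :=
  (cayley fun i => (A i).1, cayley fun i => (A i).2)

/-- The decompositions of `J` into pairwise disjoint sets `D 1, …, D n` of sizes
`b 1, …, b n`. -/
def decompositions {n k : ℕ} (J : Finset (Fin k)) (b : Fin n → ℕ) :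
    Set (Fin n → Finset (Fin k)) :=
  {D | (∀ i i', i ≠ i' → Disjoint (D i) (D i')) ∧ Finset.univ.biUnion D = J ∧
    ∀ i, (D i).card = b i}

/-- The convex hull of the union, over all decompositions `D` of `J` with sizes `b`, of the
Minkowski sums of the `B i j` with `j ∈ D i`. -/
def decompositionJoin {n k m : ℕ} (B : Fin n → Fin k → Set (Fin m → ℝ)) (J : Finset (Fin k))
    (b : Fin n → ℕ) : Set (Fin m → ℝ) :=
  convexHull ℝ (⋃ D ∈ decompositions J b, ∑ i, ∑ j ∈ D i, B i j)

/-- The same operation on pairs, componentwise. -/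
def pairDecompositionJoin {n k m : ℕ}
    (B : Fin n → Fin k → Set (Fin m → ℝ) × Set (Fin m → ℝ)) (J : Finset (Fin k))
    (b : Fin n → ℕ) : Set (Fin m → ℝ) × Set (Fin m → ℝ) :=
  (decompositionJoin (fun i j => (B i j).1) J b, decompositionJoin (fun i j => (B i j).2) J b)

end

/-!
The proof transports the identity to the space `ℝ^k = ℝ^(n-1) ⊕ ℝ^m` of the Cayley polyhedra, with
its integer lattice.

*Fibres.* The integer points of `∑_{j ∈ J} B_{1,j} * ⋯ * B_{n,j}` lie over the points `∑ bᵢ eᵢ` with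
`b₁ + ⋯ + bₙ = |J|`, and the fibre over such a point is the join of the statement
(`mem_sum_cayley_iff`). Indeed, a point of the fibre is given by a nonnegative matrix with column
sums `1` and row sums `bᵢ`; by the Birkhoff theorem such a matrix is a convex combination of
zero-one matrices with the same margins, that is, of decompositions of `J`. Hence the right-hand
side is the mixed difference `∑_J (-1)^(k-|J|) I(∑_{j ∈ J} A_j)` of the number of integer points in
Minkowski sums of the Cayley pairs `A_j`, and the theorem says that it equals the mixed difference
of the volume.

*Polynomiality.* For `f(N) = I(∑ N_j A_j)`, `N ∈ ℕ^k`, it suffices that `f` is a polynomial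
(`mixed_difference_eq_of_tendsto`). The mixed difference of `f` at scale `t` is then a polynomial in
`t` divisible by `t^k`, and it is asymptotic to `t^k` times the mixed difference of the volume, so
it is homogeneous of degree `k`, and its value at `t = 1` is the mixed difference of the volume. No
bound on the degree of `f` is needed. Polynomiality follows from the relation
`∏ᵢ ([A] - [vᵢ]) = 0` between a polytope `A` and its vertices `vᵢ` in the algebra of indicator
functions of convex sets (`sum_indicator_vertices_eq_zero`), which is inclusion-exclusion for the
Euler characteristic of compact convex sets: as translations by the integer vectors `vᵢ` do not
change the number of integer points, some power of the difference operator in the direction `A`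
annihilates the count. The relation may be multiplied by any closed convex set, so it holds for
polyhedra `conv V + C` with a fixed cone `C`, and for pairs one multiplies the relations of the two
components. Rationality of `C` plays no role.

*Pairs.* A polyhedron without lines is generated by its finitely many vertices and its recession
cone, which for a polyhedron parallel to the given cone is the cone of all translations preserving
the latter. If this cone contains a line, then the components of every bounded pair coincide and
both sides vanish. Otherwise a pair `(P, Q)` has bounded difference `P \ Q` exactly if every nonzero
recession direction eventually moves the polytope of the vertices of `P` into `Q`
(`eventually_add_smul_mem_of_isBounded_diff`, `isBounded_diff_of_eventually_add_smul_mem`), a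
condition that passes to Minkowski sums and Cayley polyhedra.
-/

open Filter Topology

/-! ### The Euler characteristic of compact convex sets -/

open Classical in
/-- One-dimensional case: the nonempty sets whose maximum is `x` have total weight `0`, since this
is the jump from `x` to the right of the vanishing function `∑ aᵢ 1_{Kᵢ}`. -/
theorem sum_nonempty_eq_zero_of_sum_indicator_real {ι : Type*} (s : Finset ι) (a : ι → ℤ)
    (K : ι → Set ℝ) (hK : ∀ i ∈ s, IsCompact (K i)) (hc : ∀ i ∈ s, Convex ℝ (K i))
    (h : ∀ x, ∑ i ∈ s, (if x ∈ K i then a i else 0) = 0) :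
    ∑ i ∈ s, (if (K i).Nonempty then a i else 0) = 0 := by
  rw [← Finset.sum_filter]
  rw [← Finset.sum_fiberwise_of_maps_to (t := (s.filter fun i => (K i).Nonempty).image
    fun i => sSup (K i)) (g := fun i => sSup (K i))
    (fun i hi => Finset.mem_image_of_mem _ hi)]
  refine Finset.sum_eq_zero fun x _ => ?_
  have ev : ∀ᶠ y in 𝓝[>] x, ∀ i ∈ s, (y ∈ K i ↔ x ∈ K i ∧ sSup (K i) ≠ x) := by
    rw [Finset.eventually_all]
    intro i hi
    have hcl := (hK i hi).isClosed
    by_cases hx : x ∈ K i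
    · by_cases hsx : sSup (K i) = x
      · filter_upwards [self_mem_nhdsWithin] with y hy
        simp only [hsx, ne_eq, not_true_eq_false, and_false, iff_false]
        intro hyK
        have := le_csSup (hK i hi).bddAbove hyK
        rw [hsx] at this
        exact absurd hy (not_lt.2 this)
      · have hlt : x < sSup (K i) :=
          lt_of_le_of_ne (le_csSup (hK i hi).bddAbove hx) (Ne.symm hsx)
        filter_upwards [Ioo_mem_nhdsGT hlt] with y hy
        simp only [hx, hsx, ne_eq, not_false_eq_true, and_self, iff_true]
        exact (hc i hi).ordConnected.out hx ((hK i hi).sSup_mem ⟨x, hx⟩) ⟨hy.1.le, hy.2.le⟩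
    · have : ∀ᶠ y in 𝓝[>] x, y ∈ (K i)ᶜ :=
        mem_nhdsWithin_of_mem_nhds (hcl.isOpen_compl.mem_nhds hx)
      filter_upwards [this] with y hy
      simp only [hx, false_and, iff_false]
      exact hy
  obtain ⟨y, hy⟩ := ev.exists
  have hxy := h x
  have hxy' := h y
  rw [← sub_eq_zero.2 (hxy.trans hxy'.symm), ← Finset.sum_sub_distrib, Finset.sum_filter, Finset.sum_filter]
  refine Finset.sum_congr rfl fun i hi => ?_
  simp only [hy i hi]
  by_cases hx : x ∈ K i
  · have : (K i).Nonempty := ⟨x, hx⟩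
    by_cases hsx : sSup (K i) = x <;> simp [hx, this, hsx]
  · by_cases hne : (K i).Nonempty
    · have : sSup (K i) ≠ x := fun e => hx (e ▸ (hK i hi).sSup_mem hne)
      simp [hx, this]
    · simp [hx, hne]

open Classical in
/-- A linear relation between the indicator functions of compact convex sets persists between the
numbers `[K ≠ ∅]`: the Euler characteristic of convex sets is well defined. By induction, the
fibres over a point of the first coordinate axis reduce the relation to the projections to
that axis. -/
theorem sum_nonempty_eq_zero_of_sum_indicator {ι : Type*} (s : Finset ι) (a : ι → ℤ) (d : ℕ) :
    ∀ (K : ι → Set (Fin d → ℝ)), (∀ i ∈ s, IsCompact (K i)) → (∀ i ∈ s, Convex ℝ (K i)) →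
    (∀ x, ∑ i ∈ s, (if x ∈ K i then a i else 0) = 0) →
    ∑ i ∈ s, (if (K i).Nonempty then a i else 0) = 0 := by
  induction d with
  | zero =>
    intro K _ _ h
    refine (Finset.sum_congr rfl fun i _ => ?_).trans (h 0)
    have : (K i).Nonempty ↔ 0 ∈ K i :=
      ⟨fun ⟨x, hx⟩ => by rwa [Subsingleton.elim 0 x], fun h => ⟨0, h⟩⟩
    simp only [this]
  | succ d ih =>
    intro K hK hc h
    let p : (Fin (d + 1) → ℝ) →ₗ[ℝ] ℝ := LinearMap.proj 0
    have hpc : Continuous p := continuous_apply 0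
    let q : (Fin (d + 1) → ℝ) →ₗ[ℝ] (Fin d → ℝ) := LinearMap.funLeft ℝ ℝ Fin.succ
    have hqc : Continuous q := continuous_pi fun i => continuous_apply i.succ
    have key := sum_nonempty_eq_zero_of_sum_indicator_real s a (fun i => p '' K i)
      (fun i hi => (hK i hi).image hpc) (fun i hi => (hc i hi).linear_image p) ?_
    · simpa only [Set.image_nonempty] using key
    intro t
    have hmem : ∀ i y, y ∈ q '' (K i ∩ {x | p x = t}) ↔ Fin.cons t y ∈ K i := by
      intro i y
      constructor
      · rintro ⟨x, ⟨hx, rfl⟩, rfl⟩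
        convert hx
        exact Fin.cons_self_tail x
      · intro hy
        exact ⟨_, ⟨hy, by simp [p]⟩, by ext j; simp [q, LinearMap.funLeft]⟩
    have := ih (fun i => q '' (K i ∩ {x | p x = t}))
      (fun i hi => ((hK i hi).inter_right (isClosed_eq hpc continuous_const)).image hqc)
      (fun i hi => ((hc i hi).inter (convex_hyperplane p.isLinear t)).linear_image q) ?_
    · refine (Finset.sum_congr rfl fun i _ => ?_).trans this
      have : t ∈ p '' K i ↔ (q '' (K i ∩ {x | p x = t})).Nonempty := by
        rw [Set.image_nonempty]
        exact Iff.rfl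
      simp only [this]
    · intro y
      simpa only [hmem] using h (Fin.cons t y)

/-! ### Inclusion-exclusion for dilated Minkowski sums -/

theorem mem_convexHull_range_iff {E : Type*} [AddCommGroup E] [Module ℝ E] {κ : Type*}
    [Fintype κ] (v : κ → E) (x : E) :
    x ∈ convexHull ℝ (Set.range v) ↔
      ∃ w : κ → ℝ, (∀ i, 0 ≤ w i) ∧ ∑ i, w i = 1 ∧ ∑ i, w i • v i = x := by
  classical
  have : Set.range v = (Fintype.linearCombination ℝ v) ''
      (Set.range fun i j : κ => if i = j then (1 : ℝ) else 0) := by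
    rw [← Set.range_comp]
    congr 1
    ext i
    simp [Fintype.linearCombination_apply]
  rw [this, ← LinearMap.image_convexHull, convexHull_basis_eq_stdSimplex]
  constructor
  · rintro ⟨w, hw, rfl⟩
    exact ⟨w, hw.1, hw.2, by simp [Fintype.linearCombination_apply]⟩
  · rintro ⟨w, h0, h1, rfl⟩
    exact ⟨w, ⟨h0, h1⟩, by simp [Fintype.linearCombination_apply]⟩

theorem mem_smul_convexHull_range_iff {E : Type*} [AddCommGroup E] [Module ℝ E] {κ : Type*}
    [Fintype κ] [Nonempty κ] (v : κ → E) {t : ℝ} (ht : 0 ≤ t) (x : E) :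
    x ∈ t • convexHull ℝ (Set.range v) ↔
      ∃ w : κ → ℝ, (∀ i, 0 ≤ w i) ∧ ∑ i, w i = t ∧ ∑ i, w i • v i = x := by
  rcases ht.eq_or_lt with rfl | ht
  · rw [Set.zero_smul_set (Set.range_nonempty v).convexHull, Set.mem_zero]
    constructor
    · rintro rfl
      exact ⟨0, by simp⟩
    · rintro ⟨w, h0, h1, rfl⟩
      rw [Finset.sum_eq_zero_iff_of_nonneg fun i _ => h0 i] at h1
      exact Finset.sum_eq_zero fun i hi => by rw [h1 i hi, zero_smul]
  · rw [Set.mem_smul_set_iff_inv_smul_mem₀ ht.ne', mem_convexHull_range_iff]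
    constructor
    · rintro ⟨w, h0, h1, h2⟩
      refine ⟨fun i => t * w i, fun i => mul_nonneg ht.le (h0 i), ?_, ?_⟩
      · rw [← Finset.mul_sum, h1, mul_one]
      · simp only [mul_smul, ← Finset.smul_sum, h2, smul_inv_smul₀ ht.ne']
    · rintro ⟨w, h0, h1, h2⟩
      refine ⟨fun i => t⁻¹ * w i, fun i => mul_nonneg (inv_nonneg.2 ht.le) (h0 i), ?_, ?_⟩
      · rw [← Finset.mul_sum, h1, inv_mul_cancel₀ ht.ne']
      · simp only [mul_smul, ← Finset.smul_sum, h2]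

/-- The relation `∏ᵢ ([A] - [vᵢ]) = 0` between a polytope `A` and its vertices `vᵢ`, multiplied by
the class of a closed convex set `P`, in the algebra of indicator functions of closed convex sets
with Minkowski sum as product. For a given `x` it is the inclusion-exclusion relation between the
pieces `cᵢ ≥ 1` of the compact convex set of all weights `c` with `x - ∑ cᵢ vᵢ ∈ P`. -/
theorem sum_indicator_vertices_eq_zero {E : Type*} [AddCommGroup E] [Module ℝ E]
    [TopologicalSpace E] [IsTopologicalAddGroup E] [ContinuousSMul ℝ E] {P : Set E}
    (hP : IsClosed P) (hPc : Convex ℝ P) {r : ℕ} (hr : 0 < r) (v : Fin r → E) (x : E) :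
    ∑ S : Finset (Fin r), (P + (((r - S.card : ℕ) : ℝ) • convexHull ℝ (Set.range v) +
      {∑ i ∈ S, v i})).indicator (fun _ => (-1 : ℤ) ^ S.card) x = 0 := by
  classical
  have : Nonempty (Fin r) := ⟨⟨0, hr⟩⟩
  let K : Finset (Fin r) → Set (Fin r → ℝ) := fun S =>
    {c | (∀ i, 0 ≤ c i) ∧ ∑ i, c i = r ∧ (∀ i ∈ S, 1 ≤ c i) ∧ x - ∑ i, c i • v i ∈ P}
  have hlin : Continuous fun c : Fin r → ℝ => x - ∑ i, c i • v i := by fun_prop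
  have hcomp : ∀ S, IsCompact (K S) := by
    intro S
    refine IsCompact.of_isClosed_subset (isCompact_univ_pi fun _ : Fin r =>
      isCompact_Icc (a := (0 : ℝ)) (b := r)) ?_ ?_
    · refine IsClosed.and ?_ (IsClosed.and ?_ (IsClosed.and ?_ ?_))
      · simp only [Set.ofPred_forall]
        exact isClosed_iInter fun i => isClosed_le continuous_const (continuous_apply i)
      · exact isClosed_eq (by fun_prop) continuous_const
      · simp only [Set.ofPred_forall]
        exact isClosed_iInter fun i => isClosed_iInter fun _ =>
          isClosed_le continuous_const (continuous_apply i)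
      · exact hP.preimage hlin
    · rintro c ⟨h0, h1, -⟩ i -
      refine ⟨h0 i, ?_⟩
      rw [← h1]
      exact Finset.single_le_sum (fun i _ => h0 i) (Finset.mem_univ i)
  have hconv : ∀ S, Convex ℝ (K S) := by
    rintro S c ⟨h0, h1, h2, h3⟩ c' ⟨h0', h1', h2', h3'⟩ a b ha hb hab
    refine ⟨fun i => ?_, ?_, fun i hi => ?_, ?_⟩
    · have := mul_nonneg ha (h0 i)
      have := mul_nonneg hb (h0' i)
      simp only [Pi.add_apply, Pi.smul_apply, smul_eq_mul]; linarith
    · simp only [Pi.add_apply, Pi.smul_apply, smul_eq_mul, Finset.sum_add_distrib,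
        ← Finset.mul_sum, h1, h1']
      rw [← add_mul, hab, one_mul]
    · have := mul_le_mul_of_nonneg_left (h2 i hi) ha
      have := mul_le_mul_of_nonneg_left (h2' i hi) hb
      simp only [Pi.add_apply, Pi.smul_apply, smul_eq_mul]; linarith
    · have := hPc h3 h3' ha hb hab
      convert this using 1
      simp only [Pi.add_apply, Pi.smul_apply, smul_eq_mul, add_smul, Finset.sum_add_distrib,
        mul_smul, ← Finset.smul_sum, smul_sub]
      rw [sub_add_sub_comm, ← add_smul, hab, one_smul]
  have hne : ∀ S : Finset (Fin r), x ∈ P + (((r - S.card : ℕ) : ℝ) • convexHull ℝ (Set.range v) +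
      {∑ i ∈ S, v i}) ↔ (K S).Nonempty := by
    intro S
    have hcard : S.card ≤ r := by simpa using S.card_le_univ
    have hs1 : ∑ i, (if i ∈ S then (1 : ℝ) else 0) = S.card := by simp
    have hs2 : ∑ i, (if i ∈ S then (1 : ℝ) else 0) • v i = ∑ i ∈ S, v i := by simp [ite_smul]
    constructor
    · rintro ⟨p, hp, y, ⟨z, hz, z', hz', rfl⟩, rfl⟩
      rw [Set.mem_singleton_iff] at hz'
      subst hz'
      obtain ⟨w, h0, h1, rfl⟩ := (mem_smul_convexHull_range_iff v (Nat.cast_nonneg _) _).1 hz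
      refine ⟨fun i => w i + if i ∈ S then 1 else 0, fun i => ?_, ?_, fun i hi => ?_, ?_⟩
      · have := h0 i
        positivity
      · rw [Finset.sum_add_distrib, h1, hs1, Nat.cast_sub hcard]; ring
      · simpa [hi] using h0 i
      · simp only [add_smul, Finset.sum_add_distrib, hs2]
        simpa using hp
    · rintro ⟨c, h0, h1, h2, h3⟩
      refine ⟨_, h3, ∑ i, c i • v i, ⟨∑ i, c i • v i - ∑ i ∈ S, v i, ?_, _, rfl, by simp⟩, by simp⟩
      refine (mem_smul_convexHull_range_iff v (Nat.cast_nonneg _) _).2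
        ⟨fun i => c i - if i ∈ S then 1 else 0, fun i => ?_, ?_, ?_⟩
      · by_cases hi : i ∈ S
        · simpa [hi] using h2 i hi
        · simpa [hi] using h0 i
      · rw [Finset.sum_sub_distrib, h1, hs1, Nat.cast_sub hcard]
      · simp only [sub_smul, Finset.sum_sub_distrib, hs2]
  have key := sum_nonempty_eq_zero_of_sum_indicator Finset.univ
    (fun S : Finset (Fin r) => (-1 : ℤ) ^ S.card) r K (fun S _ => hcomp S) (fun S _ => hconv S) ?_
  · refine (Finset.sum_congr rfl fun S _ => ?_).trans key
    simp only [Set.indicator_apply, hne]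
  intro c
  by_cases hc : c ∈ K ∅
  · obtain ⟨h0, h1, -, h3⟩ := hc
    have hmem : ∀ S, c ∈ K S ↔ S ∈ (Finset.univ.filter fun i => 1 ≤ c i).powerset := by
      intro S
      rw [Finset.mem_powerset]
      constructor
      · intro h i hi
        simpa using h.2.2.1 i hi
      · intro h
        exact ⟨h0, h1, fun i hi => by simpa using h hi, h3⟩
    simp only [hmem]
    rw [Finset.sum_ite_mem, Finset.univ_inter]
    refine Finset.sum_powerset_neg_one_pow_card_of_nonempty ?_
    -- The weights have average `1`, so one of them is at least `1`.
    by_contra hcon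
    rw [Finset.not_nonempty_iff_eq_empty, Finset.filter_eq_empty_iff] at hcon
    have : ∑ i, c i < ∑ i : Fin r, (1 : ℝ) :=
      Finset.sum_lt_sum_of_nonempty Finset.univ_nonempty fun i hi => not_le.1 (hcon hi)
    simp [h1] at this
  · refine Finset.sum_eq_zero fun S _ => ?_
    rw [if_neg]
    exact fun h => hc ⟨h.1, h.2.1, by simp, h.2.2.2⟩

/-! ### Polynomial functions on `ℕ^k` and their mixed differences -/

theorem fwdDiff_commute {M G : Type*} [AddCommMonoid M] [AddCommGroup G] (h h' : M) :
    Function.Commute (fwdDiff h : (M → G) → M → G) (fwdDiff h') := by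
  intro f
  ext y
  simp only [fwdDiff, add_right_comm y h' h]
  abel

theorem sum_finset_neg_one_pow_smul_eq_fwdDiff_iter {G : Type*} [AddCommGroup G] (r : ℕ)
    (φ : ℕ → G) (a : ℕ) :
    ∑ S : Finset (Fin r), (-1 : ℤ) ^ S.card • φ (a + (r - S.card)) = (fwdDiff 1)^[r] φ a := by
  rw [fwdDiff_iter_eq_sum_shift, ← Finset.powerset_univ, Finset.sum_powerset_apply_card
    (fun c => (-1 : ℤ) ^ c • φ (a + (r - c))), ← Finset.sum_range_reflect]
  simp only [Finset.card_univ, Fintype.card_fin]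
  refine Finset.sum_congr rfl fun i hi => ?_
  have hi : i ≤ r := Nat.lt_succ_iff.1 (Finset.mem_range.1 hi)
  have e : r + 1 - 1 - i = r - i := by omega
  rw [e, Nat.choose_symm hi, Nat.sub_sub_self hi, mul_comm, ← smul_smul, smul_eq_mul, mul_one,
    natCast_zsmul]

theorem exists_polynomial_eval_eq_choose (l : ℕ) :
    ∃ p : Polynomial ℝ, ∀ n : ℕ, p.eval (n : ℝ) = n.choose l := by
  refine ⟨Polynomial.C ((l.factorial : ℝ)⁻¹) * descPochhammer ℝ l, fun n => ?_⟩
  rw [Polynomial.eval_mul, Polynomial.eval_C, descPochhammer_eval_eq_descFactorial,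
    Nat.descFactorial_eq_factorial_mul_choose, Nat.cast_mul,
    inv_mul_cancel_left₀ (by positivity)]

/-- Newton interpolation: a function on `ℕ^k` some iterated difference of which vanishes in each
coordinate direction is a polynomial. -/
theorem exists_eq_sum_prod_polynomial (k : ℕ) : ∀ f : (Fin k → ℕ) → ℝ,
    (∀ j, ∃ D, ∀ n, (fwdDiff (Pi.single j 1))^[D] f n = 0) →
    ∃ (τ : Type) (_ : Fintype τ) (c : τ → ℝ) (p : τ → Fin k → Polynomial ℝ),
      ∀ n, f n = ∑ t, c t * ∏ j, (p t j).eval (n j : ℝ) := by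
  induction k with
  | zero =>
    intro f _
    refine ⟨Unit, inferInstance, fun _ => f 0, fun _ => Fin.elim0, fun n => ?_⟩
    simp [Subsingleton.elim n 0]
  | succ k ih =>
    intro f hf
    obtain ⟨D, hD⟩ := hf 0
    let g : ℕ → (Fin k → ℕ) → ℝ := fun l n =>
      (fwdDiff (Pi.single (0 : Fin (k + 1)) 1))^[l] f (Fin.cons 0 n)
    have hg : ∀ l : Fin D, ∃ (τ : Type) (_ : Fintype τ) (c : τ → ℝ)
        (p : τ → Fin k → Polynomial ℝ), ∀ n, g l n = ∑ t, c t * ∏ j, (p t j).eval (n j : ℝ) := by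
      intro l
      refine ih _ fun j => ?_
      obtain ⟨D', hD'⟩ := hf j.succ
      refine ⟨D', fun n => ?_⟩
      have h1 : (fwdDiff (Pi.single j 1))^[D'] (g l) n =
          (fwdDiff (Pi.single j.succ 1))^[D']
            ((fwdDiff (Pi.single (0 : Fin (k + 1)) 1))^[l] f) (Fin.cons 0 n) := by
        rw [fwdDiff_iter_eq_sum_shift, fwdDiff_iter_eq_sum_shift]
        refine Finset.sum_congr rfl fun i _ => ?_
        have e : (Fin.cons 0 (n + i • Pi.single j 1) : Fin (k + 1) → ℕ) =
            Fin.cons 0 n + i • Pi.single j.succ 1 := by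
          ext a
          refine Fin.cases ?_ (fun a => ?_) a
          · simp
          · by_cases h : a = j <;> simp [h]
        simp only [g, e]
      have hz : (fwdDiff (Pi.single j.succ 1))^[D'] f = fun _ => 0 := funext hD'
      rw [h1, ((fwdDiff_commute _ _).iterate_iterate D' l).eq f, hz, fwdDiff_iter_eq_sum_shift]
      simp
    choose τ hτ c p hp using hg
    choose q hq using exists_polynomial_eval_eq_choose
    refine ⟨Σ l : Fin D, τ l, inferInstance, fun t => c t.1 t.2,
      fun t => Fin.cons (q t.1) (p t.1 t.2), fun n => ?_⟩
    have hz : ∀ l, D ≤ l → ∀ y, (fwdDiff (Pi.single (0 : Fin (k + 1)) 1))^[l] f y = 0 := by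
      intro l hl y
      obtain ⟨e, rfl⟩ := Nat.exists_eq_add_of_le' hl
      have : (fwdDiff (Pi.single (0 : Fin (k + 1)) 1))^[D] f = fun _ => 0 := funext hD
      rw [Function.iterate_add_apply, this, fwdDiff_iter_eq_sum_shift]
      simp
    have hn : n = Fin.cons 0 (Fin.tail n) + n 0 • Pi.single (0 : Fin (k + 1)) 1 := by
      ext a
      refine Fin.cases ?_ (fun a => ?_) a
      · simp
      · simp [Fin.tail]
    rw [show f n = f (Fin.cons 0 (Fin.tail n) + n 0 • Pi.single (0 : Fin (k + 1)) 1) from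
      congrArg f hn,
      shift_eq_sum_fwdDiff_iter (Pi.single (0 : Fin (k + 1)) 1) f (n 0) (Fin.cons 0 (Fin.tail n))]
    have h2 : ∀ L, n 0 + 1 ≤ L → D ≤ L → ∑ l ∈ Finset.range (n 0 + 1),
        (n 0).choose l • (fwdDiff (Pi.single (0 : Fin (k + 1)) 1))^[l] f (Fin.cons 0 (Fin.tail n)) =
        ∑ l ∈ Finset.range D,
        (n 0).choose l •
          (fwdDiff (Pi.single (0 : Fin (k + 1)) 1))^[l] f (Fin.cons 0 (Fin.tail n)) := by
      intro L hL hL'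
      rw [Finset.sum_subset (Finset.range_mono hL), Finset.sum_subset (Finset.range_mono hL')]
      · intro l _ hl
        rw [hz l (by simpa using hl), smul_zero]
      · intro l _ hl
        rw [Nat.choose_eq_zero_of_lt (by simpa using hl), zero_smul]
    rw [h2 _ (le_max_left _ D) (le_max_right _ _), Finset.sum_range, Fintype.sum_sigma]
    refine Finset.sum_congr rfl fun l _ => ?_
    have := hp l (Fin.tail n)
    simp only [g] at this
    rw [this, nsmul_eq_mul, Finset.mul_sum]
    refine Finset.sum_congr rfl fun t _ => ?_
    rw [Fin.prod_univ_succ]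
    simp only [Fin.cons_zero, Fin.cons_succ, hq, Fin.tail]
    ring

/-- The mixed difference of a polynomial `f` on `ℕ^k` at scale `N` is a polynomial in `N` divisible
by `N ^ k`; if it is also of order at most `N ^ k`, it is homogeneous, and its value at `N = 1` is
the limit of its values divided by `N ^ k`. -/
theorem mixed_difference_eq_of_tendsto {k : ℕ} {f : (Fin k → ℕ) → ℝ}
    (hf : ∀ j, ∃ D, ∀ n, (fwdDiff (Pi.single j 1))^[D] f n = 0) {L : Finset (Fin k) → ℝ}
    (hL : ∀ J : Finset (Fin k), Tendsto
      (fun N : ℕ => f (fun j => if j ∈ J then N else 0) / (N : ℝ) ^ k) atTop (𝓝 (L J))) :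
    ∑ J : Finset (Fin k), (-1 : ℝ) ^ (k - J.card) * f (fun j => if j ∈ J then 1 else 0) =
      ∑ J : Finset (Fin k), (-1 : ℝ) ^ (k - J.card) * L J := by
  classical
  obtain ⟨τ, _, c, p, hp⟩ := exists_eq_sum_prod_polynomial k f hf
  let q : Polynomial ℝ :=
    ∑ t, Polynomial.C (c t) * ∏ j, (p t j - Polynomial.C ((p t j).eval 0))
  have hM : ∀ N : ℕ, ∑ J : Finset (Fin k),
      (-1 : ℝ) ^ (k - J.card) * f (fun j => if j ∈ J then N else 0) = q.eval (N : ℝ) := by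
    intro N
    simp only [q, Polynomial.eval_finsetSum, Polynomial.eval_mul, Polynomial.eval_C,
      Polynomial.eval_prod, Polynomial.eval_sub, hp, Finset.mul_sum]
    rw [Finset.sum_comm]
    refine Finset.sum_congr rfl fun t _ => ?_
    simp only [sub_eq_add_neg, Finset.prod_add, Finset.powerset_univ, Finset.mul_sum]
    refine Finset.sum_congr rfl fun J _ => ?_
    rw [Finset.prod_neg, Finset.card_sdiff_of_subset (Finset.subset_univ J), Finset.card_univ,
      Fintype.card_fin, ← Finset.prod_mul_prod_compl J fun j =>
        (p t j).eval (((if j ∈ J then N else 0 : ℕ) : ℝ)), ← Finset.compl_eq_univ_sdiff]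
    have h1 : ∏ j ∈ J, (p t j).eval (((if j ∈ J then N else 0 : ℕ) : ℝ)) =
        ∏ j ∈ J, (p t j).eval (N : ℝ) :=
      Finset.prod_congr rfl fun j hj => by rw [if_pos hj]
    have h2 : ∏ j ∈ Jᶜ, (p t j).eval (((if j ∈ J then N else 0 : ℕ) : ℝ)) =
        ∏ j ∈ Jᶜ, (p t j).eval 0 :=
      Finset.prod_congr rfl fun j hj => by
        rw [if_neg (Finset.mem_compl.1 hj), Nat.cast_zero]
    rw [h1, h2]
    ring
  obtain ⟨h, hh⟩ : Polynomial.X ^ k ∣ q := by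
    refine Finset.dvd_sum fun t _ => Dvd.dvd.mul_left ?_ _
    calc (Polynomial.X : Polynomial ℝ) ^ k = ∏ _j : Fin k, Polynomial.X := by simp
      _ ∣ _ := Finset.prod_dvd_prod_of_dvd _ _ fun j _ => by
        rw [Polynomial.X_dvd_iff, Polynomial.coeff_zero_eq_eval_zero]
        simp
  have hlim : Tendsto (fun N : ℕ => h.eval (N : ℝ)) atTop
      (𝓝 (∑ J : Finset (Fin k), (-1 : ℝ) ^ (k - J.card) * L J)) := by
    refine (tendsto_finsetSum _ fun J _ => (hL J).const_mul _).congr' ?_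
    filter_upwards [eventually_gt_atTop 0] with N hN
    have hN' : (N : ℝ) ^ k ≠ 0 := by positivity
    have := hM N
    rw [hh, Polynomial.eval_mul, Polynomial.eval_pow, Polynomial.eval_X] at this
    rw [← mul_right_inj' hN', ← this, Finset.mul_sum]
    refine Finset.sum_congr rfl fun J _ => ?_
    field_simp
  have hconst : h.degree ≤ 0 := by
    by_contra hd
    have := (h.abs_tendsto_atTop (not_le.1 hd)).comp
      (tendsto_natCast_atTop_atTop (R := ℝ))
    exact not_tendsto_nhds_of_tendsto_atTop this _ hlim.abs
  rw [Polynomial.eq_C_of_degree_le_zero hconst] at hlim hh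
  simp only [Polynomial.eval_C, tendsto_const_nhds_iff] at hlim
  have := hM 1
  rw [hh] at this
  simpa only [one_pow, Nat.cast_one, Polynomial.eval_mul, Polynomial.eval_pow, Polynomial.eval_X,
    one_mul, Polynomial.eval_C, hlim] using this

/-! ### Signed lattice point counts of pairs -/

/-- The signed number of points of `Λ` in a pair of sets. It is a sensible notion only if the two
differences of the pair meet `Λ` in finite sets, as `Set.ncard` vanishes on infinite sets. -/
noncomputable def signedCount {E : Type*} (Λ : Set E) (A : Set E × Set E) : ℤ :=
  ((((A.1 \ A.2) ∩ Λ).ncard : ℕ) : ℤ) - ((((A.2 \ A.1) ∩ Λ).ncard : ℕ) : ℤ)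

theorem signedCount_self {E : Type*} (Λ : Set E) (A : Set E) : signedCount Λ (A, A) = 0 := by
  simp [signedCount]

theorem signedCount_eq_sum {E : Type*} {Λ : Set E} {A : Set E × Set E} {T : Finset E}
    (hT : (T : Set E) ⊆ Λ) (hA : ∀ x ∈ Λ, (x ∈ A.1 ↔ x ∈ A.2) ∨ x ∈ T) :
    signedCount Λ A = ∑ x ∈ T, (A.1.indicator (fun _ => (1 : ℤ)) x -
      A.2.indicator (fun _ => (1 : ℤ)) x) := by
  classical
  have h1 : (A.1 \ A.2) ∩ Λ = ↑(T.filter fun x => x ∈ A.1 ∧ x ∉ A.2) := by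
    ext x
    simp only [Set.mem_inter_iff, Set.mem_sdiff, Finset.coe_filter]
    constructor
    · rintro ⟨h, hx⟩
      exact ⟨(hA x hx).resolve_left (by tauto), h⟩
    · rintro ⟨hx, h⟩
      exact ⟨h, hT hx⟩
  have h2 : (A.2 \ A.1) ∩ Λ = ↑(T.filter fun x => x ∈ A.2 ∧ x ∉ A.1) := by
    ext x
    simp only [Set.mem_inter_iff, Set.mem_sdiff, Finset.coe_filter]
    constructor
    · rintro ⟨h, hx⟩
      exact ⟨(hA x hx).resolve_left (by tauto), h⟩
    · rintro ⟨hx, h⟩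
      exact ⟨h, hT hx⟩
  rw [signedCount, h1, h2, Set.ncard_coe_finset, Set.ncard_coe_finset, Finset.card_filter,
    Finset.card_filter]
  push_cast
  rw [← Finset.sum_sub_distrib]
  refine Finset.sum_congr rfl fun x _ => ?_
  by_cases hx : x ∈ A.1 <;> by_cases hx' : x ∈ A.2 <;> simp [hx, hx']

theorem signedCount_add_singleton {E : Type*} [AddCommGroup E] (Λ : AddSubgroup E)
    (A : Set E × Set E) {v : E} (hv : v ∈ Λ) :
    signedCount (Λ : Set E) (A.1 + {v}, A.2 + {v}) = signedCount (Λ : Set E) A := by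
  have h : ∀ P Q : Set E, (((P + {v}) \ (Q + {v})) ∩ (Λ : Set E)).ncard =
      ((P \ Q) ∩ (Λ : Set E)).ncard := by
    intro P Q
    have : ((P + {v}) \ (Q + {v})) ∩ (Λ : Set E) = (fun x => x + v) '' ((P \ Q) ∩ (Λ : Set E)) := by
      ext x
      simp only [Set.mem_inter_iff, Set.mem_sdiff, Set.add_singleton, SetLike.mem_coe,
        Set.image_add_right, Set.mem_preimage]
      rw [Λ.add_mem_cancel_right (Λ.neg_mem hv)]
    rw [this, Set.ncard_image_of_injective _ (add_left_injective v)]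
  rw [signedCount, signedCount, h, h]

/-- Linear relations between the indicator functions of pairs persist between their signed
lattice point counts. -/
theorem sum_signedCount_eq_zero {E ι : Type*} {Λ : Set E} (s : Finset ι)
    (a : ι → ℤ) (A : ι → Set E × Set E)
    (hfin : ∀ i ∈ s, (((A i).1 \ (A i).2) ∩ Λ).Finite ∧ (((A i).2 \ (A i).1) ∩ Λ).Finite)
    (h : ∀ x, ∑ i ∈ s, a i * ((A i).1.indicator (fun _ => (1 : ℤ)) x -
      (A i).2.indicator (fun _ => (1 : ℤ)) x) = 0) :
    ∑ i ∈ s, a i * signedCount Λ (A i) = 0 := by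
  classical
  have hU : (⋃ i ∈ s, ((((A i).1 \ (A i).2) ∩ Λ) ∪ (((A i).2 \ (A i).1) ∩ Λ))).Finite :=
    s.finite_toSet.biUnion fun i hi => (hfin i hi).1.union (hfin i hi).2
  have hT : (hU.toFinset : Set E) ⊆ Λ := by
    rw [Set.Finite.coe_toFinset]
    exact Set.iUnion₂_subset fun i _ => Set.union_subset Set.inter_subset_right
      Set.inter_subset_right
  have : ∀ i ∈ s, signedCount Λ (A i) = ∑ x ∈ hU.toFinset,
      ((A i).1.indicator (fun _ => (1 : ℤ)) x - (A i).2.indicator (fun _ => (1 : ℤ)) x) := by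
    intro i hi
    refine signedCount_eq_sum hT fun x hx => ?_
    by_cases h : x ∈ (A i).1 ↔ x ∈ (A i).2
    · exact Or.inl h
    · refine Or.inr ?_
      rw [Set.Finite.mem_toFinset]
      refine Set.mem_biUnion hi ?_
      simp only [Set.mem_union, Set.mem_inter_iff, Set.mem_sdiff]
      tauto
  rw [Finset.sum_congr rfl fun i hi => by rw [this i hi, Finset.mul_sum], Finset.sum_comm]
  exact Finset.sum_eq_zero fun x _ => h x

theorem add_smul_add_singleton_add {E : Type*} [AddCommGroup E] [Module ℝ E] {P A : Set E}
    (hA : Convex ℝ A) (a b : ℕ) (v w : E) :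
    P + (((a + b : ℕ) : ℝ) • A + {v + w}) =
      P + ((b : ℝ) • A + {w}) + ((a : ℝ) • A + {v}) := by
  rw [Nat.cast_add, hA.add_smul (Nat.cast_nonneg _) (Nat.cast_nonneg _),
    ← Set.singleton_add_singleton]
  abel

theorem convexHull_range_isCompact {E : Type*} [AddCommGroup E] [Module ℝ E]
    [TopologicalSpace E] [IsTopologicalAddGroup E] [ContinuousSMul ℝ E] {κ : Type*} [Finite κ]
    (v : κ → E) : IsCompact (convexHull ℝ (Set.range v)) :=
  (Set.finite_range v).isCompact_convexHull ℝ

/-- Adding a pair of lattice polytopes repeatedly to a pair of closed convex sets changes the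
signed lattice point count polynomially: the relations `∏ (T - vᵢ) = 0` and `∏ (T - wⱼ) = 0` for the
two components have a common multiple, and translations by the lattice vectors `vᵢ`, `wⱼ` do not
change the count. -/
theorem fwdDiff_iter_signedCount_eq_zero {E : Type*} [AddCommGroup E] [Module ℝ E]
    [TopologicalSpace E] [IsTopologicalAddGroup E] [ContinuousSMul ℝ E] (Λ : AddSubgroup E)
    {P Q : Set E} (hP : IsClosed P) (hPc : Convex ℝ P) (hQ : IsClosed Q) (hQc : Convex ℝ Q)
    {r s : ℕ} (hr : 0 < r) (hs : 0 < s) (v : Fin r → E) (w : Fin s → E)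
    (hv : ∀ i, v i ∈ Λ) (hw : ∀ i, w i ∈ Λ)
    (hfin : ∀ t : ℕ,
      (((P + (t : ℝ) • convexHull ℝ (Set.range v)) \
        (Q + (t : ℝ) • convexHull ℝ (Set.range w))) ∩ (Λ : Set E)).Finite ∧
      (((Q + (t : ℝ) • convexHull ℝ (Set.range w)) \
        (P + (t : ℝ) • convexHull ℝ (Set.range v))) ∩ (Λ : Set E)).Finite) :
    (fwdDiff 1)^[r + s] (fun t : ℕ => signedCount (Λ : Set E)
      (P + (t : ℝ) • convexHull ℝ (Set.range v), Q + (t : ℝ) • convexHull ℝ (Set.range w))) 0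
      = 0 := by
  classical
  set A := convexHull ℝ (Set.range v) with hA
  set B := convexHull ℝ (Set.range w) with hB
  have hAc : Convex ℝ A := convex_convexHull ℝ _
  have hBc : Convex ℝ B := convex_convexHull ℝ _
  have hAk : IsCompact A := convexHull_range_isCompact v
  have hBk : IsCompact B := convexHull_range_isCompact w
  let u : Finset (Fin r) × Finset (Fin s) → E := fun S => ∑ i ∈ S.1, v i + ∑ i ∈ S.2, w i
  have hu : ∀ S, u S ∈ Λ := fun S =>
    Λ.add_mem (Λ.sum_mem fun i _ => hv i) (Λ.sum_mem fun i _ => hw i)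
  let n : Finset (Fin r) × Finset (Fin s) → ℕ := fun S => (r - S.1.card) + (s - S.2.card)
  have key := sum_signedCount_eq_zero (Λ := (Λ : Set E)) Finset.univ
    (fun S : Finset (Fin r) × Finset (Fin s) => (-1 : ℤ) ^ S.1.card * (-1 : ℤ) ^ S.2.card)
    (fun S => ((P + (n S : ℝ) • A) + {u S}, (Q + (n S : ℝ) • B) + {u S})) ?_ ?_
  · simp only [fun S => signedCount_add_singleton Λ (P + (n S : ℝ) • A, Q + (n S : ℝ) • B) (hu S)]
      at key
    rw [Function.iterate_add_apply, ← sum_finset_neg_one_pow_smul_eq_fwdDiff_iter]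
    simp only [← sum_finset_neg_one_pow_smul_eq_fwdDiff_iter, zero_add]
    rw [← key, Fintype.sum_prod_type]
    simp only [Finset.mul_sum, smul_eq_mul, mul_assoc, n]
  · intro S _
    have h : ∀ X Y : Set E, ((X \ Y) ∩ (Λ : Set E)).Finite →
        (((X + {u S}) \ (Y + {u S})) ∩ (Λ : Set E)).Finite := by
      intro X Y h
      refine (h.image fun x => x + u S).subset ?_
      rintro x ⟨⟨⟨y, hy, z, hz, rfl⟩, h2⟩, h3⟩
      rw [Set.mem_singleton_iff] at hz
      subst hz
      exact ⟨y, ⟨⟨hy, fun hy' => h2 ⟨y, hy', _, rfl, rfl⟩⟩, (Λ.add_mem_cancel_right (hu S)).1 h3⟩,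
        rfl⟩
    exact ⟨h _ _ (hfin _).1, h _ _ (hfin _).2⟩
  · intro x
    simp only [mul_sub, Finset.sum_sub_distrib]
    have hcl : ∀ {X Y : Set E}, IsClosed X → IsCompact Y → ∀ (t : ℝ) (z : E),
        IsClosed (X + (t • Y + {z})) := fun hX hY t z =>
      hX.add_right_of_isCompact ((hY.smul t).add isCompact_singleton)
    have hcv : ∀ {X Y : Set E}, Convex ℝ X → Convex ℝ Y → ∀ (t : ℝ) (z : E),
        Convex ℝ (X + (t • Y + {z})) := fun hX hY t z =>
      hX.add ((hY.smul t).add (convex_singleton z))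
    have e1 : ∀ S : Finset (Fin r) × Finset (Fin s), P + (n S : ℝ) • A + {u S} =
        P + (((s - S.2.card : ℕ) : ℝ) • A + {∑ i ∈ S.2, w i}) +
          (((r - S.1.card : ℕ) : ℝ) • A + {∑ i ∈ S.1, v i}) := fun S => by
      rw [add_assoc, add_smul_add_singleton_add hAc]
    have e2 : ∀ S : Finset (Fin r) × Finset (Fin s), Q + (n S : ℝ) • B + {u S} =
        Q + (((r - S.1.card : ℕ) : ℝ) • B + {∑ i ∈ S.1, v i}) +
          (((s - S.2.card : ℕ) : ℝ) • B + {∑ i ∈ S.2, w i}) := fun S => by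
      simp only [n, u]
      rw [add_assoc, add_comm (r - S.1.card), add_comm (∑ i ∈ S.1, v i),
        add_smul_add_singleton_add hBc]
    have hi : ∀ (X : Set E) (a : ℤ), a * X.indicator (fun _ => (1 : ℤ)) x =
        X.indicator (fun _ => a) x := by
      intro X a
      by_cases h : x ∈ X <;> simp [h]
    rw [Fintype.sum_prod_type_right, Fintype.sum_prod_type]
    rw [sub_eq_zero]
    trans 0
    · refine Finset.sum_eq_zero fun S' _ => ?_
      simp only [e1, mul_comm ((-1 : ℤ) ^ _) ((-1 : ℤ) ^ S'.card), mul_assoc]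
      rw [← Finset.mul_sum]
      simp only [hi]
      rw [sum_indicator_vertices_eq_zero (hcl hP hAk _ _) (hcv hPc hAc _ _) hr v x, mul_zero]
    · refine (Finset.sum_eq_zero fun S _ => ?_).symm
      simp only [e2, mul_assoc]
      rw [← Finset.mul_sum]
      simp only [hi]
      rw [sum_indicator_vertices_eq_zero (hcl hQ hBk _ _) (hcv hQc hBc _ _) hs w x, mul_zero]

/-! ### Mixed differences of signed counts and of volumes -/

/-- The Minkowski sum `∑ nⱼ Aⱼ + C`. -/
noncomputable def dilatedSum {E κ : Type*} [Fintype κ] [AddCommGroup E] [Module ℝ E]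
    (A : κ → Set E) (C : Set E) (n : κ → ℕ) : Set E :=
  (∑ j, (n j : ℝ) • A j) + C

theorem isCompact_sum_set {E ι : Type*} [AddCommMonoid E] [TopologicalSpace E] [ContinuousAdd E]
    (s : Finset ι) {B : ι → Set E} (hB : ∀ j ∈ s, IsCompact (B j)) :
    IsCompact (∑ j ∈ s, B j) :=
  Finset.sum_induction _ _ (fun _ _ => IsCompact.add) isCompact_singleton hB

section dilatedSum

variable {E κ : Type*} [Fintype κ] [AddCommGroup E] [Module ℝ E] {A : κ → Set E} {C : Set E}

theorem dilatedSum_add_smul_single [DecidableEq κ] (hA : ∀ j, Convex ℝ (A j))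
    (n : κ → ℕ) (j : κ) (t : ℕ) :
    dilatedSum A C (n + t • Pi.single j 1) = dilatedSum A C n + (t : ℝ) • A j := by
  have h : ∀ i, (((n + t • Pi.single j 1 : κ → ℕ) i : ℕ) : ℝ) • A i =
      (n i : ℝ) • A i + if i = j then (t : ℝ) • A j else 0 := by
    intro i
    by_cases hi : i = j
    · subst hi
      simp [(hA i).add_smul (Nat.cast_nonneg (n i)) (Nat.cast_nonneg t)]
    · simp [hi]
  simp only [dilatedSum, h, Finset.sum_add_distrib, Finset.sum_ite_eq', Finset.mem_univ, if_true]
  abel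

theorem dilatedSum_mul {N : ℕ} (hC : (N : ℝ) • C = C) (n : κ → ℕ) :
    dilatedSum A C (fun j => N * n j) = (N : ℝ) • dilatedSum A C n := by
  simp only [dilatedSum, smul_add, Finset.smul_sum, Nat.cast_mul, mul_smul, hC]

theorem dilatedSum_ite [DecidableEq κ] (hne : ∀ j, (A j).Nonempty) (J : Finset κ) :
    dilatedSum A C (fun j => if j ∈ J then 1 else 0) = ∑ j ∈ J, A j + C := by
  have h : ∀ j, ((if j ∈ J then 1 else 0 : ℕ) : ℝ) • A j = if j ∈ J then A j else 0 := by
    intro j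
    by_cases hj : j ∈ J
    · simp [hj]
    · simp [hj, Set.zero_smul_set (hne j)]
  simp only [dilatedSum, h, Finset.sum_ite_mem, Finset.univ_inter]

theorem convex_dilatedSum (hA : ∀ j, Convex ℝ (A j)) (hC : Convex ℝ C) (n : κ → ℕ) :
    Convex ℝ (dilatedSum A C n) :=
  (convex_sum _ fun j _ => (hA j).smul _).add hC

theorem isClosed_dilatedSum [TopologicalSpace E] [IsTopologicalAddGroup E] [ContinuousSMul ℝ E]
    (hA : ∀ j, IsCompact (A j)) (hC : IsClosed C) (n : κ → ℕ) :
    IsClosed (dilatedSum A C n) :=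
  hC.add_left_of_isCompact (isCompact_sum_set _ fun j _ => (hA j).smul _)

end dilatedSum

theorem smul_coe_convexCone {E : Type*} [AddCommGroup E] [Module ℝ E] (C : ConvexCone ℝ E)
    {t : ℝ} (ht : 0 < t) : t • (C : Set E) = C := by
  ext x
  rw [Set.mem_smul_set_iff_inv_smul_mem₀ ht.ne']
  exact C.smul_mem_iff (inv_pos.2 ht)

theorem fwdDiff_iter_single_eq {k : ℕ} {G : Type*} [AddCommGroup G] (f : (Fin k → ℕ) → G)
    (j : Fin k) (n : Fin k → ℕ) (D : ℕ) :
    (fwdDiff (Pi.single j 1))^[D] f n =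
      (fwdDiff 1)^[D] (fun t : ℕ => f (n + t • Pi.single j 1)) 0 := by
  simp [fwdDiff_iter_eq_sum_shift]

/-- For pairs of lattice polyhedra `conv Uⱼ + C`, `conv Wⱼ + C` in a space of dimension `k`, the
mixed difference of the signed lattice point count equals the mixed difference of the volume. -/
theorem mixed_signedCount_eq_mixed_volume {E : Type*} [NormedAddCommGroup E] [NormedSpace ℝ E]
    [FiniteDimensional ℝ E] [MeasureTheory.MeasureSpace E] [BorelSpace E]
    [(MeasureTheory.volume : MeasureTheory.Measure E).IsAddHaarMeasure]
    (Λ : AddSubgroup E)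
    (hΛ : ∀ S : Set E, Bornology.IsBounded S → (S ∩ (Λ : Set E)).Finite)
    {k : ℕ}
    (hvol : ∀ S : Set E, Bornology.IsBounded S → MeasurableSet S →
      MeasureTheory.volume (frontier S) = 0 →
      Tendsto (fun N : ℕ => ((((N : ℝ) • S) ∩ (Λ : Set E)).ncard : ℝ) / (N : ℝ) ^ k) atTop
        (𝓝 (MeasureTheory.volume.real S)))
    (U W : Fin k → Set E) (hU : ∀ j, (U j).Finite) (hW : ∀ j, (W j).Finite)
    (hUn : ∀ j, (U j).Nonempty) (hWn : ∀ j, (W j).Nonempty)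
    (hUΛ : ∀ j, U j ⊆ Λ) (hWΛ : ∀ j, W j ⊆ Λ)
    (C : ConvexCone ℝ E) (hC : IsClosed (C : Set E))
    (hbdd : ∀ n : Fin k → ℕ,
      Bornology.IsBounded (dilatedSum (fun j => convexHull ℝ (U j)) (C : Set E) n \
        dilatedSum (fun j => convexHull ℝ (W j)) (C : Set E) n) ∧
      Bornology.IsBounded (dilatedSum (fun j => convexHull ℝ (W j)) (C : Set E) n \
        dilatedSum (fun j => convexHull ℝ (U j)) (C : Set E) n)) :
    ∑ J : Finset (Fin k), (-1 : ℝ) ^ (k - J.card) * (signedCount (Λ : Set E)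
        (∑ j ∈ J, convexHull ℝ (U j) + (C : Set E), ∑ j ∈ J, convexHull ℝ (W j) + (C : Set E)) : ℝ) =
      ∑ J : Finset (Fin k), (-1 : ℝ) ^ (k - J.card) *
        pairVolume (∑ j ∈ J, convexHull ℝ (U j) + (C : Set E), ∑ j ∈ J, convexHull ℝ (W j) + (C : Set E)) := by
  classical
  set P := dilatedSum (fun j => convexHull ℝ (U j)) (C : Set E) with hPdef
  set Q := dilatedSum (fun j => convexHull ℝ (W j)) (C : Set E) with hQdef
  have hUne : ∀ j, (convexHull ℝ (U j)).Nonempty := fun j => (hUn j).convexHull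
  have hWne : ∀ j, (convexHull ℝ (W j)).Nonempty := fun j => (hWn j).convexHull
  have hUcv : ∀ j, Convex ℝ (convexHull ℝ (U j)) := fun j => convex_convexHull ℝ _
  have hWcv : ∀ j, Convex ℝ (convexHull ℝ (W j)) := fun j => convex_convexHull ℝ _
  have hPcl : ∀ n, IsClosed (P n) :=
    isClosed_dilatedSum (fun j => (hU j).isCompact_convexHull ℝ) hC
  have hQcl : ∀ n, IsClosed (Q n) :=
    isClosed_dilatedSum (fun j => (hW j).isCompact_convexHull ℝ) hC
  have hPcv : ∀ n, Convex ℝ (P n) := convex_dilatedSum hUcv C.convex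
  have hQcv : ∀ n, Convex ℝ (Q n) := convex_dilatedSum hWcv C.convex
  have hfr : ∀ X Y : Set E, Convex ℝ X → Convex ℝ Y →
      MeasureTheory.volume (frontier (X \ Y)) = 0 := by
    intro X Y hX hY
    refine MeasureTheory.measure_mono_null ?_ (MeasureTheory.measure_union_null
      (hX.addHaar_frontier MeasureTheory.volume) (hY.addHaar_frontier MeasureTheory.volume))
    rw [Set.sdiff_eq]
    refine (frontier_inter_subset _ _).trans ?_
    rw [frontier_compl]
    exact Set.union_subset_union Set.inter_subset_left Set.inter_subset_right
  have key := mixed_difference_eq_of_tendsto (k := k)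
    (f := fun n => ((signedCount (Λ : Set E) (P n, Q n) : ℤ) : ℝ))
    (L := fun J => pairVolume (∑ j ∈ J, convexHull ℝ (U j) + (C : Set E),
      ∑ j ∈ J, convexHull ℝ (W j) + (C : Set E))) ?_ ?_
  · simpa only [hPdef, hQdef, dilatedSum_ite hUne, dilatedSum_ite hWne] using key
  · intro j
    obtain ⟨r, v, -, hv⟩ := (hU j).fin_param
    obtain ⟨s, w, -, hw⟩ := (hW j).fin_param
    have hr : 0 < r := by
      obtain ⟨x, hx⟩ := hUn j
      rw [← hv] at hx
      obtain ⟨i, -⟩ := hx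
      exact i.pos
    have hs : 0 < s := by
      obtain ⟨x, hx⟩ := hWn j
      rw [← hw] at hx
      obtain ⟨i, -⟩ := hx
      exact i.pos
    refine ⟨r + s, fun n => ?_⟩
    have h1 : (fwdDiff (Pi.single j 1))^[r + s]
        (fun n => ((signedCount (Λ : Set E) (P n, Q n) : ℤ) : ℝ)) n =
        (((fwdDiff (Pi.single j 1))^[r + s]
          (fun n => signedCount (Λ : Set E) (P n, Q n)) n : ℤ) : ℝ) := by
      rw [fwdDiff_iter_eq_sum_shift, fwdDiff_iter_eq_sum_shift]
      push_cast
      refine Finset.sum_congr rfl fun i _ => ?_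
      simp
    have h2 : ∀ t : ℕ, P (n + t • Pi.single j 1) =
        P n + (t : ℝ) • convexHull ℝ (Set.range v) := fun t => by
      rw [hv]; exact dilatedSum_add_smul_single hUcv n j t
    have h3 : ∀ t : ℕ, Q (n + t • Pi.single j 1) =
        Q n + (t : ℝ) • convexHull ℝ (Set.range w) := fun t => by
      rw [hw]; exact dilatedSum_add_smul_single hWcv n j t
    rw [h1, fwdDiff_iter_single_eq]
    simp only [h2, h3]
    rw [fwdDiff_iter_signedCount_eq_zero Λ (hPcl n) (hPcv n) (hQcl n) (hQcv n) hr hs v w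
      (fun i => hUΛ j (hv ▸ Set.mem_range_self i)) (fun i => hWΛ j (hw ▸ Set.mem_range_self i)),
      Int.cast_zero]
    intro t
    rw [← h2, ← h3]
    exact ⟨hΛ _ (hbdd _).1, hΛ _ (hbdd _).2⟩
  · intro J
    have e1 := dilatedSum_ite (A := fun j => convexHull ℝ (U j)) (C := (C : Set E)) hUne J
    have e2 := dilatedSum_ite (A := fun j => convexHull ℝ (W j)) (C := (C : Set E)) hWne J
    rw [← e1, ← e2, ← hPdef, ← hQdef]
    set n : Fin k → ℕ := fun j => if j ∈ J then 1 else 0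
    have h1 := hvol (P n \ Q n) (hbdd n).1 ((hPcl n).measurableSet.diff (hQcl n).measurableSet)
      (hfr _ _ (hPcv n) (hQcv n))
    have h2 := hvol (Q n \ P n) (hbdd n).2 ((hQcl n).measurableSet.diff (hPcl n).measurableSet)
      (hfr _ _ (hQcv n) (hPcv n))
    refine (h1.sub h2).congr' ?_
    filter_upwards [eventually_gt_atTop 0] with N hN
    have hN' : (0 : ℝ) < N := by exact_mod_cast hN
    have e : (fun j => if j ∈ J then N else 0) = fun j => N * n j := by
      ext j; simp [n]
    rw [e, hPdef, hQdef, dilatedSum_mul (smul_coe_convexCone C hN'),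
      dilatedSum_mul (smul_coe_convexCone C hN'), ← hPdef, ← hQdef, signedCount,
      ← Set.smul_set_sdiff₀ hN'.ne', ← Set.smul_set_sdiff₀ hN'.ne']
    push_cast
    rw [sub_div]

/-! ### Boundedness of differences of polyhedra with a common recession cone -/

section Absorption

variable {E : Type*} [NormedAddCommGroup E] [NormedSpace ℝ E]

/-- If `(A + C) \ Q` is bounded, every nonzero direction of `C` eventually moves `A` into `Q`. -/
theorem eventually_add_smul_mem_of_isBounded_diff {A Q : Set E} {C : ConvexCone ℝ E}
    (hA : Bornology.IsBounded A) (h : Bornology.IsBounded ((A + (C : Set E)) \ Q)) {c : E}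
    (hc : c ∈ C) (hc0 : c ≠ 0) : ∀ᶠ t : ℝ in atTop, ∀ a ∈ A, a + t • c ∈ Q := by
  obtain ⟨R, hR⟩ := h.exists_norm_le
  obtain ⟨R', hR'⟩ := hA.exists_norm_le
  have hc' : 0 < ‖c‖ := norm_pos_iff.2 hc0
  filter_upwards [eventually_gt_atTop 0, eventually_gt_atTop ((R + R') / ‖c‖)] with t ht ht' a ha
  by_contra hQ
  have h1 := hR _ ⟨⟨a, ha, _, C.smul_mem ht hc, rfl⟩, hQ⟩
  have h2 := hR' a ha
  have h3 : ‖t • c‖ = t * ‖c‖ := by rw [norm_smul, Real.norm_of_nonneg ht.le]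
  have h4 : ‖t • c‖ ≤ ‖a + t • c‖ + ‖a‖ := by
    simpa using norm_sub_le (a + t • c) a
  rw [div_lt_iff₀ hc'] at ht'
  linarith

/-- The converse for a closed cone that is polyhedral, in the sense that near each `c ∈ C` the cone
is contained in `c / 2 + C`: compactness of the unit sphere of `C` makes the time at which `A`
enters `Q` uniform. -/
theorem isBounded_diff_of_eventually_add_smul_mem [ProperSpace E] {A Q : Set E}
    {C : ConvexCone ℝ E} (hC : IsClosed (C : Set E))
    (hloc : ∀ c ∈ C, ∀ᶠ c' in 𝓝[(C : Set E)] c, c' - (1 / 2 : ℝ) • c ∈ C)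
    (hA : Bornology.IsBounded A) (hQ : ∀ q ∈ Q, ∀ c ∈ C, q + c ∈ Q)
    (h : ∀ c ∈ C, c ≠ 0 → ∀ᶠ t : ℝ in atTop, ∀ a ∈ A, a + t • c ∈ Q) :
    Bornology.IsBounded ((A + (C : Set E)) \ Q) := by
  have hcomp : IsCompact (Metric.sphere (0 : E) 1 ∩ (C : Set E)) :=
    (isCompact_sphere 0 1).inter_right hC
  have huni : ∃ T : ℝ, ∀ c ∈ Metric.sphere (0 : E) 1 ∩ (C : Set E), ∀ t ≥ T, ∀ a ∈ A,
      a + t • c ∈ Q := by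
    refine hcomp.induction_on (p := fun s => ∃ T : ℝ, ∀ c ∈ s, ∀ t ≥ T, ∀ a ∈ A, a + t • c ∈ Q)
      ⟨0, by simp⟩ ?_ ?_ ?_
    · rintro s s' hs ⟨T, hT⟩
      exact ⟨T, fun c hc => hT c (hs hc)⟩
    · rintro s s' ⟨T, hT⟩ ⟨T', hT'⟩
      refine ⟨max T T', fun c hc t ht => ?_⟩
      rcases hc with hc | hc
      · exact hT c hc t ((le_max_left _ _).trans ht)
      · exact hT' c hc t ((le_max_right _ _).trans ht)
    · rintro c ⟨hc1, hcC⟩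
      have hc0 : c ≠ 0 := by
        rintro rfl
        simp at hc1
      obtain ⟨T, hT0, hT⟩ := ((eventually_gt_atTop 0).and (h c hcC hc0)).exists
      refine ⟨{c' | c' - (1 / 2 : ℝ) • c ∈ C},
        nhdsWithin_mono c Set.inter_subset_right (hloc c hcC), 2 * T + 1, fun c' hc' t ht a ha => ?_⟩
      have e : a + t • c' =
          a + T • c + (t • (c' - (1 / 2 : ℝ) • c) + (t / 2 - T) • c) := by
        simp only [smul_sub, sub_smul, smul_smul]
        rw [show t * (1 / 2) = t / 2 by ring]
        abel
      rw [e]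
      exact hQ _ (hT a ha) _
        (C.add_mem (C.smul_mem (by linarith) hc') (C.smul_mem (by linarith) hcC))
  obtain ⟨T, hT⟩ := huni
  refine (hA.add (Metric.isBounded_closedBall (x := (0 : E)) (r := max T 0))).subset ?_
  rintro x ⟨⟨a, ha, c, hc, rfl⟩, hx⟩
  refine ⟨a, ha, c, ?_, rfl⟩
  rw [mem_closedBall_zero_iff]
  by_contra hcon
  rw [not_le, max_lt_iff] at hcon
  refine hx ?_
  have := hT (‖c‖⁻¹ • c) ⟨by simp [norm_smul, inv_mul_cancel₀ hcon.2.ne'],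
    C.smul_mem (inv_pos.2 hcon.2) hc⟩ ‖c‖ hcon.1.le a ha
  rwa [smul_inv_smul₀ hcon.2.ne'] at this

theorem eventually_add_smul_mem_dilatedSum {κ : Type*} [Fintype κ] {A B : κ → Set E}
    {C : ConvexCone ℝ E} (h0 : (0 : E) ∈ C) {c : E} (hc : c ∈ C)
    (h : ∀ j, ∀ᶠ t : ℝ in atTop, ∀ a ∈ A j, a + t • c ∈ B j + (C : Set E)) (n : κ → ℕ) :
    ∀ᶠ t : ℝ in atTop, ∀ a ∈ ∑ j, (n j : ℝ) • A j, a + t • c ∈ dilatedSum B (C : Set E) n := by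
  obtain ⟨s, hs⟩ := (eventually_all.2 h).exists
  have hsm : ∀ (t : ℝ), 0 ≤ t → ∀ d ∈ C, t • d ∈ C := by
    intro t ht d hd
    rcases ht.eq_or_lt with rfl | ht
    · simpa using h0
    · exact C.smul_mem ht hd
  filter_upwards [eventually_ge_atTop ((∑ j, (n j : ℝ)) * s)] with t ht a ha
  rw [Set.mem_fintype_sum] at ha
  obtain ⟨g, hg, rfl⟩ := ha
  choose a' ha' hga using hg
  have h1 : ∀ j, ∃ b ∈ B j, ∃ d ∈ C, b + d = a' j + s • c := fun j => by
    obtain ⟨b, hb, d, hd, e⟩ := hs j (a' j) (ha' j)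
    exact ⟨b, hb, d, hd, e⟩
  choose b hb d hd e using h1
  refine ⟨∑ j, (n j : ℝ) • b j, ?_,
    ∑ j, (n j : ℝ) • d j + (t - (∑ j, (n j : ℝ)) * s) • c, ?_, ?_⟩
  · exact Set.mem_fintype_sum _ _ |>.2 ⟨_, fun j => Set.smul_mem_smul_set (hb j), rfl⟩
  · refine C.add_mem ?_ (hsm _ (by linarith) _ hc)
    exact Finset.sum_induction _ (· ∈ C) (fun _ _ hx hy => C.add_mem hx hy) h0
      fun j _ => hsm _ (Nat.cast_nonneg _) _ (hd j)
  · have : ∀ j, g j = (n j : ℝ) • b j + (n j : ℝ) • d j - ((n j : ℝ) * s) • c := by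
      intro j
      rw [← hga j, ← smul_add, e j]
      simp [smul_smul]
    simp only [this, Finset.sum_sub_distrib, Finset.sum_add_distrib, sub_smul, Finset.sum_mul,
      Finset.sum_smul]
    abel

end Absorption

/-! ### Vertices and recession cones of polyhedra -/

section Polyhedra

variable {E : Type*} [NormedAddCommGroup E] [NormedSpace ℝ E]

/-- The polyhedron defined by the inequalities `h.1 x ≤ h.2`, for `h ∈ s`. -/
def polyhedron (s : Finset ((E →ₗ[ℝ] ℝ) × ℝ)) : Set E := {x | ∀ h ∈ s, h.1 x ≤ h.2}

/-- The cone defined by the homogeneous inequalities `h.1 x ≤ 0` belonging to a system of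
inequalities `h.1 x ≤ h.2`. -/
def recessionCone (s : Finset ((E →ₗ[ℝ] ℝ) × ℝ)) : ConvexCone ℝ E where
  carrier := {a | ∀ h ∈ s, h.1 a ≤ 0}
  smul_mem' := fun t ht a ha h hh => by
    simpa using mul_nonpos_of_nonneg_of_nonpos ht.le (ha h hh)
  add_mem' := fun a ha b hb h hh => by
    simpa using add_nonpos (ha h hh) (hb h hh)

theorem mem_recessionCone {s : Finset ((E →ₗ[ℝ] ℝ) × ℝ)} {a : E} :
    a ∈ recessionCone s ↔ ∀ h ∈ s, h.1 a ≤ 0 := Iff.rfl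

theorem zero_mem_recessionCone (s : Finset ((E →ₗ[ℝ] ℝ) × ℝ)) : (0 : E) ∈ recessionCone s := by
  simp [mem_recessionCone]

theorem isClosed_recessionCone [FiniteDimensional ℝ E] (s : Finset ((E →ₗ[ℝ] ℝ) × ℝ)) :
    IsClosed (recessionCone s : Set E) := by
  have : (recessionCone s : Set E) = ⋂ h ∈ s, {a | h.1 a ≤ 0} := by
    ext a; simp [mem_recessionCone]
  rw [this]
  exact isClosed_biInter fun h _ =>
    isClosed_le h.1.continuous_of_finiteDimensional continuous_const

theorem eventually_sub_half_smul_mem_recessionCone [FiniteDimensional ℝ E]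
    (s : Finset ((E →ₗ[ℝ] ℝ) × ℝ)) {c : E} (hc : c ∈ recessionCone s) :
    ∀ᶠ c' in 𝓝[(recessionCone s : Set E)] c, c' - (1 / 2 : ℝ) • c ∈ recessionCone s := by
  simp only [mem_recessionCone, map_sub, map_smul, smul_eq_mul]
  rw [Finset.eventually_all]
  intro h hh
  rcases (hc h hh).eq_or_lt with h0 | h0
  · filter_upwards [self_mem_nhdsWithin] with c' hc'
    rw [h0, mul_zero, sub_zero]
    exact hc' h hh
  · have hcont : Continuous h.1 := h.1.continuous_of_finiteDimensional
    have : ∀ᶠ c' in 𝓝 c, h.1 c' < 1 / 2 * h.1 c :=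
      (hcont.tendsto c).eventually (gt_mem_nhds (by linarith))
    filter_upwards [mem_nhdsWithin_of_mem_nhds this] with c' hc'
    have : h.1 c' < 1 / 2 * h.1 c := hc'
    linarith

theorem add_smul_mem_of_vadd_subset {P : Set E} {a : E} (h : a +ᵥ P ⊆ P) {x : E} (hx : x ∈ P)
    (N : ℕ) : x + (N : ℝ) • a ∈ P := by
  induction N with
  | zero => simpa using hx
  | succ N ih =>
    have := h (Set.vadd_mem_vadd_set ih)
    rw [vadd_eq_add] at this
    convert this using 1
    push_cast
    rw [add_smul, one_smul]
    abel

theorem eq_zero_of_isBounded {S : Set E} (hS : Bornology.IsBounded S) {x a : E}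
    (h : ∀ N : ℕ, x + (N : ℝ) • a ∈ S) : a = 0 := by
  obtain ⟨R, hR⟩ := hS.exists_norm_le
  by_contra ha
  have ha' : 0 < ‖a‖ := norm_pos_iff.2 ha
  obtain ⟨N, hN⟩ := exists_nat_gt ((R + ‖x‖) / ‖a‖)
  rw [div_lt_iff₀ ha'] at hN
  have h1 := hR _ (h N)
  have h2 : ‖(N : ℝ) • a‖ ≤ ‖x + (N : ℝ) • a‖ + ‖x‖ := by
    simpa using norm_sub_le (x + (N : ℝ) • a) x
  rw [norm_smul, Real.norm_natCast] at h2
  linarith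

theorem vadd_polyhedron_subset_iff {s : Finset ((E →ₗ[ℝ] ℝ) × ℝ)} (hne : (polyhedron s).Nonempty)
    (a : E) : a +ᵥ polyhedron s ⊆ polyhedron s ↔ a ∈ recessionCone s := by
  constructor
  · intro h
    obtain ⟨x, hx⟩ := hne
    intro f hf
    by_contra hpos
    rw [not_le] at hpos
    obtain ⟨N, hN'⟩ := exists_nat_gt ((f.2 - f.1 x) / f.1 a)
    have := add_smul_mem_of_vadd_subset h hx N f hf
    simp only [map_add, map_smul, smul_eq_mul] at this
    rw [div_lt_iff₀ hpos] at hN'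
    linarith
  · rintro h _ ⟨x, hx, rfl⟩ f hf
    have h1 := h f hf
    have h2 := hx f hf
    simp only [vadd_eq_add, map_add]
    linarith

/-- Moving from a point of a polyhedron in a direction that preserves the active inequalities
and is not a recession direction makes a further inequality active. -/
theorem exists_add_smul_mem_polyhedron {s : Finset ((E →ₗ[ℝ] ℝ) × ℝ)} {x d : E}
    (hx : x ∈ polyhedron s) (hd : ∀ h ∈ s, h.1 x = h.2 → h.1 d = 0) (hrec : d ∉ recessionCone s) :
    ∃ t : ℝ, 0 < t ∧ x + t • d ∈ polyhedron s ∧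
      (s.filter fun h => h.1 (x + t • d) < h.2).card < (s.filter fun h => h.1 x < h.2).card := by
  have hne : (s.filter fun h => 0 < h.1 d).Nonempty := by
    simp only [mem_recessionCone, not_forall, not_le] at hrec
    obtain ⟨h, hh, hpos⟩ := hrec
    exact ⟨h, Finset.mem_filter.2 ⟨hh, hpos⟩⟩
  obtain ⟨f, hf, hmin⟩ := Finset.exists_min_image _ (fun h => (h.2 - h.1 x) / h.1 d) hne
  rw [Finset.mem_filter] at hf
  have hinact : ∀ h ∈ s, 0 < h.1 d → h.1 x < h.2 := fun h hh hpos =>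
    lt_of_le_of_ne (hx h hh) fun e => hpos.ne' (hd h hh e)
  set t := (f.2 - f.1 x) / f.1 d
  have ht : 0 < t := div_pos (sub_pos.2 (hinact f hf.1 hf.2)) hf.2
  have hft : f.1 (x + t • d) = f.2 := by
    simp only [map_add, map_smul, smul_eq_mul, t]
    rw [div_mul_cancel₀ _ hf.2.ne']
    ring
  refine ⟨t, ht, fun h hh => ?_, Finset.card_lt_card ?_⟩
  · simp only [map_add, map_smul, smul_eq_mul]
    rcases le_or_gt (h.1 d) 0 with hle | hpos
    · have := mul_nonpos_of_nonneg_of_nonpos ht.le hle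
      have := hx h hh
      linarith
    · have := hmin h (Finset.mem_filter.2 ⟨hh, hpos⟩)
      rw [le_div_iff₀ hpos] at this
      linarith
  · rw [Finset.ssubset_iff_of_subset]
    · exact ⟨f, Finset.mem_filter.2 ⟨hf.1, hinact f hf.1 hf.2⟩, fun h =>
        (Finset.mem_filter.1 h).2.ne hft⟩
    · intro h hh
      rw [Finset.mem_filter] at hh ⊢
      refine ⟨hh.1, lt_of_le_of_ne (hx h hh.1) fun e => ?_⟩
      have h2 := hh.2
      simp [hd h hh.1 e, e] at h2

/-- A polyhedron that contains no line is generated by its extreme points and its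
recession cone. -/
theorem polyhedron_subset_convexHull_add {s : Finset ((E →ₗ[ℝ] ℝ) × ℝ)}
    (hline : ∀ a ∈ recessionCone s, -a ∈ recessionCone s → a = 0) :
    polyhedron s ⊆ convexHull ℝ ((polyhedron s).extremePoints ℝ) + (recessionCone s : Set E) := by
  have hconv : Convex ℝ
      (convexHull ℝ ((polyhedron s).extremePoints ℝ) + (recessionCone s : Set E)) :=
    (convex_convexHull ℝ _).add (recessionCone s).convex
  have hadd : ∀ y ∈ convexHull ℝ ((polyhedron s).extremePoints ℝ) + (recessionCone s : Set E),
      ∀ c ∈ recessionCone s,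
      y + c ∈ convexHull ℝ ((polyhedron s).extremePoints ℝ) + (recessionCone s : Set E) := by
    rintro _ ⟨a, ha, b, hb, rfl⟩ c hc
    exact ⟨a, ha, b + c, (recessionCone s).add_mem hb hc, (add_assoc _ _ _).symm⟩
  suffices H : ∀ N x, x ∈ polyhedron s → (s.filter fun h => h.1 x < h.2).card = N →
      x ∈ convexHull ℝ ((polyhedron s).extremePoints ℝ) + (recessionCone s : Set E) from
    fun x hx => H _ x hx rfl
  intro N
  induction N using Nat.strong_induction_on with
  | _ N ih =>
    rintro x hx rfl
    by_cases hK : ∃ d, d ≠ 0 ∧ ∀ h ∈ s, h.1 x = h.2 → h.1 d = 0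
    · obtain ⟨d, hd0, hd⟩ := hK
      have hd' : ∀ h ∈ s, h.1 x = h.2 → h.1 (-d) = 0 := fun h hh e => by simp [hd h hh e]
      by_cases h1 : d ∈ recessionCone s
      · have h2 : -d ∉ recessionCone s := fun h2 => hd0 (hline d h1 h2)
        obtain ⟨t, ht, hmem, hlt⟩ := exists_add_smul_mem_polyhedron hx hd' h2
        have := hadd _ (ih _ hlt _ hmem rfl) _ ((recessionCone s).smul_mem ht h1)
        simpa using this
      · obtain ⟨t, ht, hmem, hlt⟩ := exists_add_smul_mem_polyhedron hx hd h1
        by_cases h2 : -d ∈ recessionCone s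
        · have := hadd _ (ih _ hlt _ hmem rfl) _ ((recessionCone s).smul_mem ht h2)
          simpa using this
        · obtain ⟨t', ht', hmem', hlt'⟩ := exists_add_smul_mem_polyhedron hx hd' h2
          have hs : 0 < t + t' := by linarith
          have := hconv (ih _ hlt _ hmem rfl) (ih _ hlt' _ hmem' rfl)
            (a := t' / (t + t')) (b := t / (t + t')) (by positivity) (by positivity)
            (by field_simp; ring)
          convert this using 1
          have e1 : t' / (t + t') + t / (t + t') = 1 := by field_simp; ring
          have e2 : t' / (t + t') * t - t / (t + t') * t' = 0 := by ring
          calc x = (t' / (t + t') + t / (t + t')) • x +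
                (t' / (t + t') * t - t / (t + t') * t') • d := by
                rw [e1, e2, one_smul, zero_smul, add_zero]
            _ = _ := by
                simp only [add_smul, sub_smul, smul_add, smul_smul, smul_neg]
                abel
    · push Not at hK
      refine ⟨x, subset_convexHull ℝ _ ?_, 0, zero_mem_recessionCone s, add_zero x⟩
      refine ⟨hx, fun y hy z hz hxyz => ?_⟩
      obtain ⟨a, b, ha, hb, hab, rfl⟩ := hxyz
      have hyz : y - z = 0 := by
        by_contra hne
        obtain ⟨h, hh, e, hne'⟩ := hK _ hne
        refine hne' ?_
        have h1 := hy h hh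
        have h2 := hz h hh
        simp only [map_add, map_smul, smul_eq_mul] at e
        obtain rfl : b = 1 - a := by linarith
        have hb' := hb
        rw [map_sub]
        have e' : a * (h.2 - h.1 y) + (1 - a) * (h.2 - h.1 z) = 0 := by linarith
        have p1 := mul_nonneg ha.le (sub_nonneg.2 h1)
        have p2 := mul_nonneg hb.le (sub_nonneg.2 h2)
        have q1 : a * (h.2 - h.1 y) = 0 := by linarith
        have q2 : (1 - a) * (h.2 - h.1 z) = 0 := by linarith
        rcases mul_eq_zero.1 q1 with q1 | q1
        · exact absurd q1 ha.ne'
        rcases mul_eq_zero.1 q2 with q2 | q2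
        · exact absurd q2 hb.ne'
        linarith
      rw [sub_eq_zero] at hyz
      subst hyz
      rw [← add_smul, hab, one_smul]

/-- An extreme point of a polyhedron is determined by its active inequalities. -/
theorem finite_extremePoints_polyhedron (s : Finset ((E →ₗ[ℝ] ℝ) × ℝ)) :
    ((polyhedron s).extremePoints ℝ).Finite := by
  classical
  refine Set.Finite.of_injOn (f := fun x => s.filter fun h => h.1 x = h.2)
    (t := (s.powerset : Set (Finset ((E →ₗ[ℝ] ℝ) × ℝ)))) ?_ ?_ (Finset.finite_toSet _)
  · intro x _
    exact Finset.mem_coe.2 (Finset.mem_powerset.2 (Finset.filter_subset _ _))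
  · intro x hx y hy hxy
    simp only [Finset.ext_iff, Finset.mem_filter, and_congr_right_iff] at hxy
    have hev : ∀ᶠ ε in 𝓝[>] (0 : ℝ), ∀ h ∈ s,
        h.1 (x + ε • (y - x)) ≤ h.2 ∧ h.1 (x - ε • (y - x)) ≤ h.2 := by
      rw [Finset.eventually_all]
      intro h hh
      rcases (hx.1 h hh).eq_or_lt with e | hlt
      · refine Eventually.of_forall fun ε => ?_
        simp [e, (hxy h hh).1 e]
      · simp only [map_add, map_sub, map_smul, smul_eq_mul]
        have h1 : ∀ᶠ ε in 𝓝 (0 : ℝ), h.1 x + ε * (h.1 y - h.1 x) < h.2 :=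
          (Continuous.tendsto (by fun_prop) 0).eventually (gt_mem_nhds (by simpa using hlt))
        have h2 : ∀ᶠ ε in 𝓝 (0 : ℝ), h.1 x - ε * (h.1 y - h.1 x) < h.2 :=
          (Continuous.tendsto (by fun_prop) 0).eventually (gt_mem_nhds (by simpa using hlt))
        filter_upwards [mem_nhdsWithin_of_mem_nhds h1, mem_nhdsWithin_of_mem_nhds h2] with ε a b
        exact ⟨le_of_lt a, le_of_lt b⟩
    obtain ⟨ε, hε, hpos⟩ := (hev.and self_mem_nhdsWithin).exists
    have hpos : 0 < ε := hpos
    have := hx.2 (x₁ := x + ε • (y - x)) (fun h hh => (hε h hh).1)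
      (x₂ := x - ε • (y - x)) (fun h hh => (hε h hh).2)
      ⟨1 / 2, 1 / 2, by norm_num, by norm_num, by norm_num, by
        rw [← smul_add, add_add_sub_cancel, ← two_smul ℝ x, smul_smul]; norm_num⟩
    rw [add_eq_left, smul_eq_zero, sub_eq_zero] at this
    exact (this.resolve_left hpos.ne').symm

theorem polyhedron_eq_convexHull_add {s : Finset ((E →ₗ[ℝ] ℝ) × ℝ)}
    (hline : ∀ a ∈ recessionCone s, -a ∈ recessionCone s → a = 0) :
    polyhedron s = convexHull ℝ ((polyhedron s).extremePoints ℝ) + (recessionCone s : Set E) := by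
  refine (polyhedron_subset_convexHull_add hline).antisymm ?_
  have hconv : Convex ℝ (polyhedron s) := by
    intro x hx y hy a b ha hb hab h hh
    have h1 := mul_le_mul_of_nonneg_left (hx h hh) ha
    have h2 := mul_le_mul_of_nonneg_left (hy h hh) hb
    simp only [map_add, map_smul, smul_eq_mul]
    calc _ ≤ a * h.2 + b * h.2 := add_le_add h1 h2
      _ = h.2 := by rw [← add_mul, hab, one_mul]
  rintro _ ⟨x, hx, a, ha, rfl⟩ h hh
  have h1 := convexHull_min extremePoints_subset hconv hx h hh
  have h2 := ha h hh
  simp only [map_add]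
  linarith

end Polyhedra

/-! ### Integer points in products of coordinate spaces -/

/-- The integer lattice as a subgroup of `ℝ^m`. -/
def latticeSubgroup (m : ℕ) : AddSubgroup (Fin m → ℝ) where
  carrier := latticePoints m
  zero_mem' := fun _ => ⟨0, by simp⟩
  add_mem' := fun {x y} hx hy i => by
    obtain ⟨a, ha⟩ := hx i
    obtain ⟨b, hb⟩ := hy i
    exact ⟨a + b, by simp [ha, hb]⟩
  neg_mem' := fun {x} hx i => by
    obtain ⟨a, ha⟩ := hx i
    exact ⟨-a, by simp [ha]⟩

theorem coe_prod_latticeSubgroup (a m : ℕ) :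
    (((latticeSubgroup a).prod (latticeSubgroup m) : AddSubgroup _) :
      Set ((Fin a → ℝ) × (Fin m → ℝ))) = latticePoints a ×ˢ latticePoints m := rfl

theorem finite_inter_latticePoints {m : ℕ} {S : Set (Fin m → ℝ)} (hS : Bornology.IsBounded S) :
    (S ∩ latticePoints m).Finite := by
  obtain ⟨R, hR⟩ := hS.exists_norm_le
  refine ((Set.Finite.pi' fun _ : Fin m => Set.finite_Icc (-⌈R⌉) ⌈R⌉).image
    fun (z : Fin m → ℤ) i => (z i : ℝ)).subset ?_
  rintro x ⟨hx, hxl⟩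
  choose z hz using hxl
  refine ⟨z, fun i => ?_, funext fun i => (hz i).symm⟩
  have h1 : |x i| ≤ R := (norm_le_pi_norm x i).trans (hR x hx)
  rw [hz i, abs_le] at h1
  have h2 := Int.le_ceil R
  constructor
  · have : ((-⌈R⌉ : ℤ) : ℝ) ≤ z i := by push_cast; linarith
    exact_mod_cast this
  · have : (z i : ℝ) ≤ (⌈R⌉ : ℤ) := by linarith
    exact_mod_cast this

theorem finite_inter_prod_latticePoints {a m : ℕ} {S : Set ((Fin a → ℝ) × (Fin m → ℝ))}
    (hS : Bornology.IsBounded S) : (S ∩ latticePoints a ×ˢ latticePoints m).Finite := by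
  refine ((finite_inter_latticePoints hS.image_fst).prod
    (finite_inter_latticePoints hS.image_snd)).subset ?_
  rintro x ⟨hx, h1, h2⟩
  exact ⟨⟨⟨x, hx, rfl⟩, h1⟩, ⟨⟨x, hx, rfl⟩, h2⟩⟩

theorem mem_span_range_basisFun_iff {ι : Type*} [Fintype ι] (x : ι → ℝ) :
    x ∈ Submodule.span ℤ (Set.range (Pi.basisFun ℝ ι)) ↔ ∀ i, ∃ z : ℤ, x i = z := by
  rw [Module.Basis.mem_span_iff_repr_mem]
  simp only [Pi.basisFun_repr, Set.mem_range, algebraMap_int_eq, eq_intCast, eq_comm]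

/-- The number of integer points in the dilations of a bounded set with negligible boundary is
asymptotic to the volume. -/
theorem tendsto_ncard_smul_inter_div_pow {a m : ℕ} (S : Set ((Fin a → ℝ) × (Fin m → ℝ)))
    (hb : Bornology.IsBounded S) (hm : MeasurableSet S)
    (hf : MeasureTheory.volume (frontier S) = 0) :
    Tendsto (fun N : ℕ => ((((N : ℝ) • S) ∩ latticePoints a ×ˢ latticePoints m).ncard : ℝ) /
      (N : ℝ) ^ (a + m)) atTop (𝓝 (MeasureTheory.volume.real S)) := by
  let L := LinearEquiv.sumArrowLequivProdArrow (Fin a) (Fin m) ℝ ℝ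
  let e := L.toContinuousLinearEquiv
  have hmp : MeasureTheory.MeasurePreserving e
      (MeasureTheory.volume : MeasureTheory.Measure (Fin a ⊕ Fin m → ℝ)) MeasureTheory.volume :=
    MeasureTheory.volume_measurePreserving_sumPiEquivProdPi fun _ : Fin a ⊕ Fin m => ℝ
  have h1 : Bornology.IsBounded (e ⁻¹' S) := by
    rw [← e.image_symm_eq_preimage]
    exact e.symm.lipschitz.isBounded_image hb
  have h2 : MeasureTheory.volume (frontier (e ⁻¹' S)) = 0 := by
    have := e.toHomeomorph.preimage_frontier S
    rw [show (e : (Fin a ⊕ Fin m → ℝ) → _) = e.toHomeomorph from rfl, ← this]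
    exact (hmp.measure_preimage (measurableSet_frontier).nullMeasurableSet).trans hf
  have key := tendsto_card_div_pow_atTop_volume (e ⁻¹' S) h1 (hm.preimage hmp.measurable) h2
  rw [hmp.measureReal_preimage hm.nullMeasurableSet] at key
  refine key.congr' ?_
  filter_upwards [eventually_gt_atTop 0] with N hN
  have hN' : (N : ℝ) ≠ 0 := by positivity
  have hset : ((N : ℝ) • S) ∩ latticePoints a ×ˢ latticePoints m = (fun x => (N : ℝ) • e x) ''
      (e ⁻¹' S ∩ (N : ℝ)⁻¹ •
        (Submodule.span ℤ (Set.range (Pi.basisFun ℝ (Fin a ⊕ Fin m))) : Set _)) := by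
    ext y
    constructor
    · rintro ⟨⟨x, hx, rfl⟩, hl1, hl2⟩
      refine ⟨e.symm x, ⟨by simpa using hx, ?_⟩, by simp⟩
      rw [Set.mem_inv_smul_set_iff₀ hN', SetLike.mem_coe, mem_span_range_basisFun_iff]
      rintro (i | i)
      · exact hl1 i
      · exact hl2 i
    · rintro ⟨x, ⟨hx, hl⟩, rfl⟩
      rw [Set.mem_inv_smul_set_iff₀ hN', SetLike.mem_coe, mem_span_range_basisFun_iff] at hl
      exact ⟨⟨_, hx, rfl⟩, fun i => hl (Sum.inl i), fun i => hl (Sum.inr i)⟩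
  have hinj : Function.Injective fun x => (N : ℝ) • e x :=
    (smul_right_injective _ hN').comp e.injective
  rw [hset, Set.ncard_image_of_injective _ hinj]
  simp [Set.ncard]

/-! ### Fibres of Minkowski sums of Cayley polyhedra -/

/-- A point of a transportation polytope with integral margins is a convex combination of
zero-one matrices, which are the decompositions of `J` with sizes `b`. Splitting the row `i` into
`b i` equal rows yields a doubly stochastic matrix, to which the Birkhoff theorem applies. -/
theorem exists_decompositions_of_margins {n k : ℕ} (J : Finset (Fin k)) (b : Fin n → ℕ)
    (l : Fin n → Fin k → ℝ) (hl : ∀ i, ∀ j ∈ J, 0 ≤ l i j) (hcol : ∀ j ∈ J, ∑ i, l i j = 1)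
    (hrow : ∀ i, ∑ j ∈ J, l i j = b i) :
    ∃ (τ : Type) (_ : Fintype τ) (w : τ → ℝ) (D : τ → Fin n → Finset (Fin k)),
      (∀ t, 0 < w t) ∧ ∑ t, w t = 1 ∧ (∀ t, D t ∈ decompositions J b) ∧
      ∀ i, ∀ j ∈ J, l i j = ∑ t, if j ∈ D t i then w t else 0 := by
  classical
  have hsum : ∑ i, b i = J.card := by
    have : ((∑ i, b i : ℕ) : ℝ) = (J.card : ℕ) := by
      push_cast
      simp only [← hrow]
      rw [Finset.sum_comm, Finset.sum_congr rfl hcol]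
      simp
    exact_mod_cast this
  let ε : J ≃ Σ i, Fin (b i) := Fintype.equivOfCardEq (by simp [hsum])
  let M : Matrix J J ℝ := fun j j' => l (ε j').1 j / b (ε j').1
  have hzero : ∀ i, b i = 0 → ∀ j ∈ J, l i j = 0 := by
    intro i hi j hj
    have h := hrow i
    rw [hi, Nat.cast_zero, Finset.sum_eq_zero_iff_of_nonneg (hl i)] at h
    exact h j hj
  have hblock : ∀ (i : Fin n) (j : J), ∑ s : Fin (b i), l i j / b i = l i j := by
    intro i j
    rw [Finset.sum_const, Finset.card_univ, Fintype.card_fin, nsmul_eq_mul]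
    rcases Nat.eq_zero_or_pos (b i) with h | h
    · rw [hzero i h j j.2]; simp
    · field_simp
  have hM : M ∈ doublyStochastic ℝ J := by
    rw [mem_doublyStochastic_iff_sum]
    refine ⟨fun j j' => div_nonneg (hl _ _ j.2) (Nat.cast_nonneg _), fun j => ?_, fun j' => ?_⟩
    · rw [← hcol j j.2, ← ε.symm.sum_comp]
      simp only [M, Equiv.apply_symm_apply, Fintype.sum_sigma, hblock]
    · have hpos : 0 < b (ε j').1 := (ε j').2.pos
      simp only [M]
      rw [← Finset.sum_div, Finset.sum_coe_sort J fun j => l (ε j').1 j, hrow]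
      field_simp
  obtain ⟨w, hw0, hw1, hwM⟩ := exists_eq_sum_perm_of_mem_doublyStochastic hM
  let D : Equiv.Perm J → Fin n → Finset (Fin k) := fun σ i =>
    (Finset.univ.filter fun j : J => (ε (σ j)).1 = i).map (Function.Embedding.subtype _)
  have hD : ∀ σ i (j : J), (j : Fin k) ∈ D σ i ↔ (ε (σ j)).1 = i := by
    intro σ i j
    simp [D]
  have hDJ : ∀ σ i j, j ∈ D σ i → j ∈ J := by
    intro σ i j hj
    simp only [D, Finset.mem_map, Finset.mem_filter, Function.Embedding.coe_subtype] at hj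
    obtain ⟨j', -, rfl⟩ := hj
    exact j'.2
  have hentry : ∀ j j' : J, M j j' = ∑ σ, if σ j = j' then w σ else 0 := by
    intro j j'
    rw [← hwM, Matrix.sum_apply]
    refine Finset.sum_congr rfl fun σ _ => ?_
    simp [Equiv.Perm.permMatrix, PEquiv.toMatrix_apply, eq_comm]
  have hl' : ∀ i (j : J), l i j = ∑ σ, if (j : Fin k) ∈ D σ i then w σ else 0 := by
    intro i j
    have h1 : l i j = ∑ s : Fin (b i), M j (ε.symm ⟨i, s⟩) := by
      rw [← hblock i j]
      refine Finset.sum_congr rfl fun s _ => ?_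
      simp [M]
    rw [h1]
    simp only [hentry, hD]
    rw [Finset.sum_comm]
    refine Finset.sum_congr rfl fun σ _ => ?_
    simp only [Equiv.eq_symm_apply]
    obtain ⟨i', s'⟩ := ε (σ j)
    by_cases h : i' = i
    · subst h
      simp
    · simp [h]
  have hsub : ∀ f : Equiv.Perm J → ℝ, (∀ σ, f σ ≠ 0 → w σ ≠ 0) →
      ∑ σ : {σ // w σ ≠ 0}, f σ = ∑ σ, f σ := by
    intro f hf
    rw [← Finset.sum_filter_of_ne fun σ _ h => hf σ h]
    exact (Finset.sum_subtype _ (by simp) f).symm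
  refine ⟨{σ // w σ ≠ 0}, inferInstance, fun σ => w σ, fun σ => D σ,
    fun σ => lt_of_le_of_ne (hw0 _) (Ne.symm σ.2), ?_, fun σ => ⟨?_, ?_, ?_⟩, fun i j hj => ?_⟩
  · rw [hsub w fun _ h => h, hw1]
  · intro i i' hii
    rw [Finset.disjoint_left]
    intro j hj hj'
    have h := hDJ _ _ _ hj
    exact hii (((hD σ i ⟨j, h⟩).1 hj).symm.trans ((hD σ i' ⟨j, h⟩).1 hj'))
  · ext j
    simp only [Finset.mem_biUnion, Finset.mem_univ, true_and]
    exact ⟨fun ⟨i, hi⟩ => hDJ _ _ _ hi, fun hj => ⟨_, (hD σ _ ⟨j, hj⟩).2 rfl⟩⟩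
  · intro i
    rw [Finset.card_map, Finset.card_filter]
    refine ((σ.1.trans ε).sum_comp
      fun x : Σ i, Fin (b i) => if x.1 = i then 1 else 0).trans ?_
    rw [Fintype.sum_sigma, Finset.sum_eq_single i]
    · simp
    · intro i' _ hi'
      simp [hi']
    · simp
  · rw [hl' i ⟨j, hj⟩]
    exact (hsub (fun σ => if j ∈ D σ i then w σ else 0)
      fun σ h hw => h (by simp [hw])).symm

section Fibres

variable {n k m : ℕ}

/-- The point `∑ cᵢ eᵢ` of the cone over the standard simplex. -/
noncomputable def simplexPoint (c : Fin n → ℝ) : Fin (n - 1) → ℝ := ∑ i, c i • simplexVertex i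

theorem simplexPoint_apply (c : Fin n → ℝ) (l : Fin (n - 1)) :
    simplexPoint c l = c ⟨l, l.2.trans_le (Nat.sub_le _ _)⟩ := by
  simp only [simplexPoint, Finset.sum_apply, Pi.smul_apply, simplexVertex, smul_eq_mul, mul_ite,
    mul_one, mul_zero]
  rw [Finset.sum_eq_single ⟨l, l.2.trans_le (Nat.sub_le _ _)⟩]
  · simp
  · intro i _ hi
    rw [if_neg]
    exact fun e => hi (Fin.ext e.symm)
  · simp

theorem sum_eq_sum_add_last (hn : 1 ≤ n) (c : Fin n → ℝ) :
    ∑ i, c i = ∑ l : Fin (n - 1), c ⟨l, l.2.trans_le (Nat.sub_le _ _)⟩ +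
      c ⟨n - 1, Nat.sub_lt hn one_pos⟩ := by
  obtain ⟨n, rfl⟩ := Nat.exists_eq_add_of_le' hn
  exact Fin.sum_univ_castSucc c

theorem simplexPoint_injective (hn : 1 ≤ n) {c c' : Fin n → ℝ}
    (h : simplexPoint c = simplexPoint c') (hs : ∑ i, c i = ∑ i, c' i) : c = c' := by
  have h1 : ∀ l : Fin (n - 1), c ⟨l, l.2.trans_le (Nat.sub_le _ _)⟩ =
      c' ⟨l, l.2.trans_le (Nat.sub_le _ _)⟩ := fun l => by
    simpa only [simplexPoint_apply] using congrFun h l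
  ext i
  by_cases hi : (i : ℕ) < n - 1
  · exact h1 ⟨i, hi⟩
  · rw [sum_eq_sum_add_last hn, sum_eq_sum_add_last hn, Finset.sum_congr rfl fun l _ => h1 l,
      add_right_inj] at hs
    have : i = ⟨n - 1, Nat.sub_lt hn one_pos⟩ := Fin.ext (by have := i.2; simp; omega)
    rw [this, hs]

theorem exists_of_mem_cayley {Δ : Fin n → Set (Fin m → ℝ)} (hΔ : ∀ i, Convex ℝ (Δ i))
    {x : (Fin (n - 1) → ℝ) × (Fin m → ℝ)} (hx : x ∈ cayley Δ) :
    ∃ (l : Fin n → ℝ) (β : Fin n → Fin m → ℝ), (∀ i, 0 ≤ l i) ∧ ∑ i, l i = 1 ∧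
      (∀ i, l i ≠ 0 → β i ∈ Δ i) ∧ x = (simplexPoint l, ∑ i, l i • β i) := by
  classical
  rw [cayley, mem_convexHull_iff_exists_fintype] at hx
  obtain ⟨ι, _, w, z, hw0, hw1, hz, rfl⟩ := hx
  simp only [Set.mem_iUnion, Set.mem_prod, Set.mem_singleton_iff] at hz
  choose f hf1 hf2 using hz
  let l : Fin n → ℝ := fun i => ∑ t with f t = i, w t
  have hl0 : ∀ i, 0 ≤ l i := fun i => Finset.sum_nonneg fun t _ => hw0 t
  have hβ : ∀ i, l i • (Finset.univ.filter fun t => f t = i).centerMass w (fun t => (z t).2) =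
      ∑ t with f t = i, w t • (z t).2 := by
    intro i
    rw [Finset.centerMass, smul_smul]
    rcases (hl0 i).eq_or_lt with h | h
    · rw [← h, zero_mul, zero_smul]
      refine (Finset.sum_eq_zero fun t ht => ?_).symm
      rw [(Finset.sum_eq_zero_iff_of_nonneg fun t _ => hw0 t).1 h.symm t ht, zero_smul]
    · rw [mul_inv_cancel₀ h.ne', one_smul]
  refine ⟨l, fun i => (Finset.univ.filter fun t => f t = i).centerMass w (fun t => (z t).2),
    hl0, ?_, fun i hi => ?_, ?_⟩
  · rw [← hw1]
    exact Finset.sum_fiberwise _ f w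
  · refine (hΔ i).centerMass_mem (fun t _ => hw0 t) (lt_of_le_of_ne (hl0 i) (Ne.symm hi)) ?_
    intro t ht
    rw [← (Finset.mem_filter.1 ht).2]
    exact hf2 t
  · simp only [hβ]
    rw [Finset.sum_fiberwise _ f fun t => w t • (z t).2]
    refine Prod.ext ?_ ?_
    · simp only [Prod.fst_sum, Prod.smul_fst, hf1, simplexPoint, l, Finset.sum_smul]
      rw [← Finset.sum_fiberwise _ f fun t => w t • simplexVertex (f t)]
      refine Finset.sum_congr rfl fun i _ => Finset.sum_congr rfl fun t ht => ?_
      rw [(Finset.mem_filter.1 ht).2]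
    · simp only [Prod.snd_sum, Prod.smul_snd]

theorem exists_of_mem_sum_cayley {B : Fin n → Fin k → Set (Fin m → ℝ)}
    (hB : ∀ i j, Convex ℝ (B i j)) {J : Finset (Fin k)}
    {x : (Fin (n - 1) → ℝ) × (Fin m → ℝ)} (hx : x ∈ ∑ j ∈ J, cayley fun i => B i j) :
    ∃ (l : Fin n → Fin k → ℝ) (β : Fin n → Fin k → Fin m → ℝ), (∀ i, ∀ j ∈ J, 0 ≤ l i j) ∧
      (∀ j ∈ J, ∑ i, l i j = 1) ∧ (∀ i, ∀ j ∈ J, l i j ≠ 0 → β i j ∈ B i j) ∧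
      x = (simplexPoint fun i => ∑ j ∈ J, l i j, ∑ j ∈ J, ∑ i, l i j • β i j) := by
  rw [Set.mem_finsetSum] at hx
  obtain ⟨g, hg, rfl⟩ := hx
  have h : ∀ j, ∃ (l : Fin n → ℝ) (β : Fin n → Fin m → ℝ), j ∈ J → (∀ i, 0 ≤ l i) ∧
      ∑ i, l i = 1 ∧ (∀ i, l i ≠ 0 → β i ∈ B i j) ∧ g j = (simplexPoint l, ∑ i, l i • β i) := by
    intro j
    by_cases hj : j ∈ J
    · obtain ⟨l, β, h⟩ := exists_of_mem_cayley (fun i => hB i j) (hg hj)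
      exact ⟨l, β, fun _ => h⟩
    · exact ⟨0, 0, fun h => absurd h hj⟩
  choose l β h using h
  refine ⟨fun i j => l j i, fun i j => β j i, fun i j hj => (h j hj).1 i, fun j hj => (h j hj).2.1,
    fun i j hj => (h j hj).2.2.1 i, ?_⟩
  rw [Finset.sum_congr rfl fun j hj => (h j hj).2.2.2]
  refine Prod.ext ?_ ?_
  · simp only [Prod.fst_sum, simplexPoint, Finset.sum_smul]
    exact Finset.sum_comm
  · simp only [Prod.snd_sum]

/-- The fibre of a Minkowski sum of Cayley polyhedra over an integer point of the dilated
simplex. -/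
theorem mem_sum_cayley_iff (hn : 1 ≤ n) {B : Fin n → Fin k → Set (Fin m → ℝ)}
    (hB : ∀ i j, Convex ℝ (B i j)) {J : Finset (Fin k)} {b : Fin n → ℕ} (hb : ∑ i, b i = J.card)
    (y : Fin m → ℝ) :
    (simplexPoint (fun i => (b i : ℝ)), y) ∈ ∑ j ∈ J, cayley (fun i => B i j) ↔
      y ∈ decompositionJoin B J b := by
  classical
  constructor
  · intro h
    obtain ⟨l, β, hl0, hl1, hβ, e⟩ := exists_of_mem_sum_cayley hB h
    rw [Prod.mk.injEq] at e
    obtain ⟨e1, rfl⟩ := e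
    have hrow : ∀ i, ∑ j ∈ J, l i j = b i := by
      refine fun i => (congrFun (simplexPoint_injective hn e1 ?_) i).symm
      rw [Finset.sum_comm, Finset.sum_congr rfl hl1]
      simp [← hb]
    obtain ⟨τ, _, w, D, hw0, hw1, hD, hlD⟩ := exists_decompositions_of_margins J b l hl0 hl1 hrow
    have hDJ : ∀ t i, D t i ⊆ J := fun t i => by
      rw [← (hD t).2.1]
      exact Finset.subset_biUnion_of_mem (D t) (Finset.mem_univ i)
    have hy : ∑ j ∈ J, ∑ i, l i j • β i j = ∑ t, w t • ∑ i, ∑ j ∈ D t i, β i j := by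
      have h1 : ∀ t, ∑ i, ∑ j ∈ D t i, β i j =
          ∑ j ∈ J, ∑ i, if j ∈ D t i then β i j else 0 := by
        intro t
        rw [Finset.sum_comm]
        refine Finset.sum_congr rfl fun i _ => ?_
        rw [Finset.sum_ite_mem, Finset.inter_eq_right.2 (hDJ t i)]
      simp only [h1, Finset.smul_sum]
      symm
      rw [Finset.sum_comm]
      refine Finset.sum_congr rfl fun j hj => ?_
      rw [Finset.sum_comm]
      refine Finset.sum_congr rfl fun i _ => ?_
      rw [hlD i j hj, Finset.sum_smul]
      refine Finset.sum_congr rfl fun t _ => ?_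
      by_cases h : j ∈ D t i <;> simp [h]
    rw [hy]
    refine (convex_convexHull ℝ _).sum_mem (fun t _ => (hw0 t).le) hw1 fun t _ =>
      subset_convexHull ℝ _ (Set.mem_biUnion (hD t) ?_)
    refine Set.mem_fintype_sum _ _ |>.2 ⟨_, fun i => Set.mem_finsetSum _ _ _ |>.2
      ⟨fun j => β i j, fun {j} hj => hβ i j (hDJ t i hj) ?_, rfl⟩, rfl⟩
    rw [hlD i j (hDJ t i hj)]
    refine (lt_of_lt_of_le (hw0 t) ?_).ne'
    have := Finset.single_le_sum (f := fun t => if j ∈ D t i then w t else 0)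
      (fun t _ => by split_ifs; exacts [(hw0 t).le, le_rfl]) (Finset.mem_univ t)
    simpa [hj] using this
  · intro h
    have hconv : Convex ℝ (∑ j ∈ J, cayley (fun i => B i j)) :=
      convex_sum _ fun j _ => convex_convexHull ℝ _
    have hpre : Convex ℝ {y : Fin m → ℝ | (simplexPoint (fun i => (b i : ℝ)), y) ∈
        ∑ j ∈ J, cayley (fun i => B i j)} := by
      intro y hy z hz p q hp hq hpq
      have := hconv hy hz hp hq hpq
      rwa [Prod.smul_mk, Prod.smul_mk, Prod.mk_add_mk, ← add_smul, hpq, one_smul] at this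
    refine convexHull_min ?_ hpre h
    refine Set.iUnion₂_subset fun D hD y hy => ?_
    obtain ⟨g, hg, rfl⟩ := (Set.mem_fintype_sum _ _).1 hy
    have hdis : ∀ i ∈ (Finset.univ : Finset (Fin n)), ∀ i' ∈ (Finset.univ : Finset (Fin n)),
        i ≠ i' → Disjoint (D i) (D i') := fun i _ i' _ => hD.1 i i'
    rw [Set.mem_ofPred_eq, ← hD.2.1, Finset.sum_biUnion hdis, Set.mem_fintype_sum]
    refine ⟨fun i => ((b i : ℝ) • simplexVertex i, g i), fun i => ?_, ?_⟩
    · obtain ⟨β, hβ, e⟩ := (Set.mem_finsetSum _ _ _).1 (hg i)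
      refine (Set.mem_finsetSum _ _ _).2 ⟨fun j => (simplexVertex i, β j), fun {j} hj =>
        subset_convexHull ℝ _ (Set.mem_iUnion.2 ⟨i, rfl, hβ hj⟩), ?_⟩
      refine Prod.ext ?_ ?_
      · rw [Prod.fst_sum, Finset.sum_const, hD.2.2 i]
        exact (Nat.cast_smul_eq_nsmul ℝ _ _).symm
      · simpa [Prod.snd_sum] using e
    · refine Prod.ext ?_ ?_
      · simp [Prod.fst_sum, simplexPoint]
      · simp [Prod.snd_sum]

theorem simplexPoint_mem_latticePoints (b : Fin n → ℕ) :
    simplexPoint (fun i => (b i : ℝ)) ∈ latticePoints (n - 1) := fun l =>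
  ⟨b ⟨l, l.2.trans_le (Nat.sub_le _ _)⟩, by rw [simplexPoint_apply]; simp⟩

/-- The integer points of a Minkowski sum of Cayley polyhedra lie over the integer points of the
dilated simplex. -/
theorem exists_natCast_eq_of_mem_sum_cayley (hn : 1 ≤ n) {B : Fin n → Fin k → Set (Fin m → ℝ)}
    (hB : ∀ i j, Convex ℝ (B i j)) {J : Finset (Fin k)}
    {x : (Fin (n - 1) → ℝ) × (Fin m → ℝ)} (hx : x ∈ ∑ j ∈ J, cayley fun i => B i j)
    (hx1 : x.1 ∈ latticePoints (n - 1)) :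
    ∃ b : Fin n → ℕ, ∑ i, b i = J.card ∧ x.1 = simplexPoint fun i => (b i : ℝ) := by
  obtain ⟨l, β, hl0, hl1, -, rfl⟩ := exists_of_mem_sum_cayley hB hx
  set c : Fin n → ℝ := fun i => ∑ j ∈ J, l i j
  have hc0 : ∀ i, 0 ≤ c i := fun i => Finset.sum_nonneg fun j hj => hl0 i j hj
  have hcs : ∑ i, c i = J.card := by
    simp only [c]
    rw [Finset.sum_comm, Finset.sum_congr rfl hl1]
    simp
  have hcz : ∀ i, ∃ z : ℤ, c i = z := by
    have h1 : ∀ q : Fin (n - 1), ∃ z : ℤ, c ⟨q, q.2.trans_le (Nat.sub_le _ _)⟩ = z := fun q => by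
      simpa only [simplexPoint_apply] using hx1 q
    intro i
    by_cases hi : (i : ℕ) < n - 1
    · exact h1 ⟨i, hi⟩
    · choose z hz using h1
      have : i = ⟨n - 1, Nat.sub_lt hn one_pos⟩ := Fin.ext (by have := i.2; simp; omega)
      refine ⟨J.card - ∑ q, z q, ?_⟩
      rw [sum_eq_sum_add_last hn, Finset.sum_congr rfl fun q _ => hz q, ← this] at hcs
      push_cast
      linarith
  have hcn : ∀ i, ∃ b : ℕ, c i = b := by
    intro i
    obtain ⟨z, hz⟩ := hcz i
    have h0 : (0 : ℝ) ≤ z := hz ▸ hc0 i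
    lift z to ℕ using (by exact_mod_cast h0)
    exact ⟨z, by simpa using hz⟩
  choose b hb using hcn
  refine ⟨b, ?_, ?_⟩
  · have : ((∑ i, b i : ℕ) : ℝ) = J.card := by
      push_cast
      rw [← hcs]
      exact Finset.sum_congr rfl fun i _ => (hb i).symm
    exact_mod_cast this
  · exact congrArg simplexPoint (funext hb)

/-- Counting the integer points of a part of a Minkowski sum of Cayley polyhedra fibre by fibre. -/
theorem ncard_inter_eq_sum_latticeCount (hn : 1 ≤ n) {B : Fin n → Fin k → Set (Fin m → ℝ)}
    (hB : ∀ i j, Convex ℝ (B i j)) {J : Finset (Fin k)}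
    {Z : Set ((Fin (n - 1) → ℝ) × (Fin m → ℝ))} (hZ : Z ⊆ ∑ j ∈ J, cayley (fun i => B i j))
    {F : (Fin n → ℕ) → Set (Fin m → ℝ)}
    (hF : ∀ b : Fin n → ℕ, ∑ i, b i = J.card → ∀ y,
      (simplexPoint (fun i => (b i : ℝ)), y) ∈ Z ↔ y ∈ F b)
    (hbd : Bornology.IsBounded Z) :
    (Z ∩ latticePoints (n - 1) ×ˢ latticePoints m).ncard =
      ∑ b ∈ Finset.piAntidiag (Finset.univ : Finset (Fin n)) J.card, latticeCount (F b) := by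
  classical
  have hfin := finite_inter_prod_latticePoints hbd
  set X := Z ∩ latticePoints (n - 1) ×ˢ latticePoints m with hX
  have hmem : ∀ b : Fin n → ℕ, ∑ i, b i = J.card → ∀ y,
      (simplexPoint (fun i => (b i : ℝ)), y) ∈ X ↔
        y ∈ F b ∩ latticePoints m := by
    intro b hb y
    simp only [hX, Set.mem_inter_iff, hF b hb, Set.mem_prod, simplexPoint_mem_latticePoints,
      true_and]
  have hpi : ∀ b : Fin n → ℕ, b ∈ Finset.piAntidiag (Finset.univ : Finset (Fin n)) J.card ↔
      ∑ i, b i = J.card := fun b => by simp [Finset.mem_piAntidiag]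
  have hXeq : hfin.toFinset = (Finset.piAntidiag (Finset.univ : Finset (Fin n)) J.card).biUnion
      fun b => hfin.toFinset.filter fun x => x.1 = simplexPoint fun i => (b i : ℝ) := by
    ext x
    simp only [Finset.mem_biUnion, Finset.mem_filter, Set.Finite.mem_toFinset, hpi]
    constructor
    · intro hx
      obtain ⟨b, hb, e⟩ := exists_natCast_eq_of_mem_sum_cayley hn hB (hZ hx.1) hx.2.1
      exact ⟨b, hb, hx, e⟩
    · rintro ⟨b, -, hx, -⟩
      exact hx
  rw [Set.ncard_eq_toFinset_card _ hfin, hXeq, Finset.card_biUnion]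
  · refine Finset.sum_congr rfl fun b hb => ?_
    rw [hpi] at hb
    rw [latticeCount, ← Set.ncard_image_of_injective _
      (Prod.mk_right_injective (simplexPoint fun i => (b i : ℝ))), ← Set.ncard_coe_finset]
    congr 1
    ext ⟨p, y⟩
    simp only [Finset.coe_filter, Set.Finite.mem_toFinset, Set.mem_image, Prod.mk.injEq]
    constructor
    · rintro ⟨hx, rfl⟩
      exact ⟨y, (hmem b hb y).1 hx, rfl, rfl⟩
    · rintro ⟨y, hy, rfl, rfl⟩
      exact ⟨(hmem b hb y).2 hy, rfl⟩
  · intro b hb b' hb' hne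
    rw [Function.onFun, Finset.disjoint_left]
    intro x hx hx'
    rw [Finset.mem_filter] at hx hx'
    rw [Finset.mem_coe, hpi] at hb hb'
    refine hne (funext fun i => ?_)
    have := congrFun (simplexPoint_injective hn (hx.2.symm.trans hx'.2)
      (by exact_mod_cast hb.trans hb'.symm)) i
    exact_mod_cast this

/-- Counting the integer points of a pair of Minkowski sums of Cayley polyhedra fibre by fibre. -/
theorem signedCount_sum_cayley (hn : 1 ≤ n) {B B' : Fin n → Fin k → Set (Fin m → ℝ)}
    (hB : ∀ i j, Convex ℝ (B i j)) (hB' : ∀ i j, Convex ℝ (B' i j)) (J : Finset (Fin k))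
    (h1 : Bornology.IsBounded
      ((∑ j ∈ J, cayley (fun i => B i j)) \ (∑ j ∈ J, cayley (fun i => B' i j))))
    (h2 : Bornology.IsBounded
      ((∑ j ∈ J, cayley (fun i => B' i j)) \ (∑ j ∈ J, cayley (fun i => B i j)))) :
    signedCount (latticePoints (n - 1) ×ˢ latticePoints m)
      (∑ j ∈ J, cayley (fun i => B i j), ∑ j ∈ J, cayley (fun i => B' i j)) =
    ∑ b ∈ Finset.piAntidiag (Finset.univ : Finset (Fin n)) J.card,
      pairLatticeCount (decompositionJoin B J b, decompositionJoin B' J b) := by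
  have hF : ∀ {A A' : Fin n → Fin k → Set (Fin m → ℝ)}, (∀ i j, Convex ℝ (A i j)) →
      (∀ i j, Convex ℝ (A' i j)) → ∀ b : Fin n → ℕ, ∑ i, b i = J.card → ∀ y,
      (simplexPoint (fun i => (b i : ℝ)), y) ∈
        (∑ j ∈ J, cayley (fun i => A i j)) \ (∑ j ∈ J, cayley (fun i => A' i j)) ↔
      y ∈ decompositionJoin A J b \ decompositionJoin A' J b := fun hA hA' b hb y => by
    rw [Set.mem_sdiff, Set.mem_sdiff, mem_sum_cayley_iff hn hA hb, mem_sum_cayley_iff hn hA' hb]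
  rw [signedCount, ncard_inter_eq_sum_latticeCount hn hB Set.sdiff_subset (hF hB hB') h1,
    ncard_inter_eq_sum_latticeCount hn hB' Set.sdiff_subset (hF hB' hB) h2]
  push_cast
  rw [← Finset.sum_sub_distrib]
  rfl

end Fibres

/-! ### Cayley polyhedra of finitely generated families -/

/-- The cone `{0} × R` in `ℝ^(n-1) × ℝ^m`. -/
def verticalCone (n : ℕ) {m : ℕ} (R : ConvexCone ℝ (Fin m → ℝ)) :
    ConvexCone ℝ ((Fin (n - 1) → ℝ) × (Fin m → ℝ)) where
  carrier := {0} ×ˢ (R : Set (Fin m → ℝ))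
  smul_mem' := fun t ht x ⟨h, hx⟩ => ⟨by
    have h : x.1 = 0 := h
    simp [h], R.smul_mem ht hx⟩
  add_mem' := fun x ⟨h, hx⟩ y ⟨h', hy⟩ => ⟨by
    have h : x.1 = 0 := h
    have h' : y.1 = 0 := h'
    simp [h, h'], R.add_mem hx hy⟩

theorem mk_mem_verticalCone (n : ℕ) {m : ℕ} {R : ConvexCone ℝ (Fin m → ℝ)} {c : Fin m → ℝ}
    (hc : c ∈ R) : ((0 : Fin (n - 1) → ℝ), c) ∈ verticalCone n R := ⟨rfl, hc⟩

section Assembly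

variable {n k m : ℕ}

/-- The vertices `(eᵢ, v)`, `v ∈ V i`, of a Cayley polyhedron. -/
def cayleyVertices (V : Fin n → Set (Fin m → ℝ)) : Set ((Fin (n - 1) → ℝ) × (Fin m → ℝ)) :=
  ⋃ i, {simplexVertex i} ×ˢ V i

theorem singleton_prod_convexHull_subset (V : Fin n → Set (Fin m → ℝ)) (i : Fin n) :
    {simplexVertex i} ×ˢ convexHull ℝ (V i) ⊆ convexHull ℝ (cayleyVertices V) := by
  rw [← convexHull_singleton (𝕜 := ℝ) (simplexVertex i), ← convexHull_prod]
  exact convexHull_mono (Set.subset_iUnion (fun i => {simplexVertex i} ×ˢ V i) i)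

theorem cayley_convexHull_add (V : Fin n → Set (Fin m → ℝ)) (R : ConvexCone ℝ (Fin m → ℝ)) :
    cayley (fun i => convexHull ℝ (V i) + (R : Set (Fin m → ℝ))) =
      convexHull ℝ (cayleyVertices V) +
        (verticalCone n R : Set ((Fin (n - 1) → ℝ) × (Fin m → ℝ))) := by
  have h1 : (⋃ i : Fin n, {simplexVertex i} ×ˢ (convexHull ℝ (V i) + (R : Set (Fin m → ℝ)))) =
      (⋃ i : Fin n, {simplexVertex i} ×ˢ convexHull ℝ (V i)) +
        (verticalCone n R : Set ((Fin (n - 1) → ℝ) × (Fin m → ℝ))) := by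
    rw [Set.iUnion_add]
    refine Set.iUnion_congr fun i => ?_
    ext ⟨p, y⟩
    constructor
    · rintro ⟨hp, v, hv, c, hc, rfl⟩
      exact ⟨(p, v), ⟨hp, hv⟩, (0, c), ⟨rfl, hc⟩, by simp⟩
    · rintro ⟨⟨p', v⟩, ⟨hp, hv⟩, ⟨p'', c⟩, ⟨hp', hc⟩, e⟩
      obtain ⟨rfl, rfl⟩ := Prod.mk.inj e
      have hp' : p'' = 0 := hp'
      subst hp'
      exact ⟨by simpa using hp, v, hv, c, hc, rfl⟩
  rw [cayley, h1, convexHull_add, (verticalCone n R).convex.convexHull_eq]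
  congr 1
  refine (convexHull_min ?_ (convex_convexHull ℝ _)).antisymm
    (convexHull_mono (Set.iUnion_mono fun i =>
      Set.prod_mono le_rfl (subset_convexHull ℝ _)))
  exact Set.iUnion_subset fun i => singleton_prod_convexHull_subset V i

theorem sum_add_coe_convexCone {E ι : Type*} [AddCommGroup E] [Module ℝ E] {C : ConvexCone ℝ E}
    (h0 : (0 : E) ∈ C) {J : Finset ι} (hJ : J.Nonempty) (A : ι → Set E) :
    ∑ j ∈ J, (A j + (C : Set E)) = ∑ j ∈ J, A j + (C : Set E) := by
  have hCC : (C : Set E) + (C : Set E) = C := by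
    refine Set.Subset.antisymm ?_ fun x hx => ⟨x, hx, 0, h0, add_zero x⟩
    rintro _ ⟨x, hx, y, hy, rfl⟩
    exact C.add_mem hx hy
  rw [Finset.sum_add_distrib]
  congr 1
  induction hJ using Finset.Nonempty.cons_induction with
  | singleton a => simp
  | cons a s ha _ ih => rw [Finset.sum_cons, ih, hCC]

theorem finite_cayleyVertices {V : Fin n → Set (Fin m → ℝ)} (hV : ∀ i, (V i).Finite) :
    (cayleyVertices V).Finite :=
  Set.finite_iUnion fun i => (Set.finite_singleton _).prod (hV i)

theorem nonempty_cayleyVertices {V : Fin n → Set (Fin m → ℝ)} (hV : ∃ i, (V i).Nonempty) :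
    (cayleyVertices V).Nonempty := by
  obtain ⟨i, v, hv⟩ := hV
  exact ⟨(simplexVertex i, v), Set.mem_iUnion.2 ⟨i, rfl, hv⟩⟩

theorem cayleyVertices_subset {V : Fin n → Set (Fin m → ℝ)} (hV : ∀ i, V i ⊆ latticePoints m) :
    cayleyVertices V ⊆ latticePoints (n - 1) ×ˢ latticePoints m := by
  refine Set.iUnion_subset fun i => Set.prod_mono ?_ (hV i)
  rintro _ rfl l
  by_cases h : (l : ℕ) = i
  · exact ⟨1, by simp [simplexVertex, h]⟩
  · exact ⟨0, by simp [simplexVertex, h]⟩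

/-- Boundedness of the differences of pairs passes to Minkowski sums of Cayley pairs. -/
theorem isBounded_diff_dilatedSum_cayleyVertices {κ : Type*} [Fintype κ]
    {R : ConvexCone ℝ (Fin m → ℝ)} (hR : IsClosed (R : Set (Fin m → ℝ)))
    (h0 : (0 : Fin m → ℝ) ∈ R)
    (hloc : ∀ c ∈ R, ∀ᶠ c' in 𝓝[(R : Set (Fin m → ℝ))] c, c' - (1 / 2 : ℝ) • c ∈ R)
    {V V' : Fin n → κ → Set (Fin m → ℝ)} (hV : ∀ i j, (V i j).Finite)
    (hb : ∀ i j, Bornology.IsBounded ((convexHull ℝ (V i j) + (R : Set (Fin m → ℝ))) \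
      (convexHull ℝ (V' i j) + (R : Set (Fin m → ℝ))))) (N : κ → ℕ) :
    Bornology.IsBounded
      (dilatedSum (fun j => convexHull ℝ (cayleyVertices fun i => V i j))
        (verticalCone n R : Set ((Fin (n - 1) → ℝ) × (Fin m → ℝ))) N \
      dilatedSum (fun j => convexHull ℝ (cayleyVertices fun i => V' i j))
        (verticalCone n R : Set ((Fin (n - 1) → ℝ) × (Fin m → ℝ))) N) := by
  have hfin : ∀ j, (cayleyVertices fun i => V i j).Finite := fun j =>
    finite_cayleyVertices fun i => hV i j
  refine isBounded_diff_of_eventually_add_smul_mem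
    (A := ∑ j, (N j : ℝ) • convexHull ℝ (cayleyVertices fun i => V i j)) ?_ ?_ ?_ ?_ ?_
  · exact isClosed_singleton.prod hR
  · rintro ⟨p, c⟩ ⟨hp, hc⟩
    have hp : p = 0 := hp
    subst hp
    have h1 : Tendsto Prod.snd
        (𝓝[(verticalCone n R : Set ((Fin (n - 1) → ℝ) × (Fin m → ℝ)))] ((0 : Fin (n - 1) → ℝ), c))
        (𝓝[(R : Set (Fin m → ℝ))] c) :=
      tendsto_nhdsWithin_iff.2 ⟨(continuous_snd.tendsto _).mono_left nhdsWithin_le_nhds,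
        eventually_nhdsWithin_of_forall fun x hx => hx.2⟩
    filter_upwards [h1.eventually (hloc c hc), self_mem_nhdsWithin] with x hx hx'
    exact ⟨by simpa using hx'.1, hx⟩
  · exact (isCompact_sum_set _ fun j _ => ((hfin j).isCompact_convexHull ℝ).smul _).isBounded
  · rintro _ ⟨a, ha, d, hd, rfl⟩ c hc
    exact ⟨a, ha, d + c, (verticalCone n R).add_mem hd hc, (add_assoc _ _ _).symm⟩
  · rintro ⟨p, c⟩ ⟨hp, hc⟩ hc0
    have hp : p = 0 := hp
    subst hp
    have hc0 : c ≠ 0 := fun h => hc0 (by rw [h]; rfl)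
    refine eventually_add_smul_mem_dilatedSum (mk_mem_verticalCone n h0) (mk_mem_verticalCone n hc) (fun j => ?_) N
    have h1 : ∀ᶠ t : ℝ in atTop, ∀ i, ∀ a ∈ convexHull ℝ (V i j),
        a + t • c ∈ convexHull ℝ (V' i j) + (R : Set (Fin m → ℝ)) :=
      eventually_all.2 fun i => eventually_add_smul_mem_of_isBounded_diff
        (((hV i j).isCompact_convexHull ℝ).isBounded) (hb i j) hc hc0
    filter_upwards [h1] with t ht
    have hconv : Convex ℝ {a : (Fin (n - 1) → ℝ) × (Fin m → ℝ) | a + t • ((0 : Fin (n - 1) → ℝ), c)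
        ∈ convexHull ℝ (cayleyVertices fun i => V' i j) +
          (verticalCone n R : Set ((Fin (n - 1) → ℝ) × (Fin m → ℝ)))} :=
      ((convex_convexHull ℝ _).add (verticalCone n R).convex).translate_preimage_left _
    refine convexHull_min (Set.iUnion_subset fun i => ?_) hconv
    rintro ⟨p, v⟩ ⟨hp, hv⟩
    obtain ⟨b, hb, d, hd, e⟩ := ht i v (subset_convexHull ℝ _ hv)
    refine ⟨(p, b), singleton_prod_convexHull_subset (fun i => V' i j) i ⟨hp, hb⟩, (0, d),
      ⟨rfl, hd⟩, ?_⟩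
    simp [← e]

/-- The identity between the lattice point counts and the volumes for pairs that are generated by
finite sets of integer points and a common closed polyhedral cone. -/
theorem sum_pairLatticeCount_eq_sum_pairVolume (hn : 1 ≤ n) (hk : k = n - 1 + m)
    {R : ConvexCone ℝ (Fin m → ℝ)} (hR : IsClosed (R : Set (Fin m → ℝ)))
    (h0 : (0 : Fin m → ℝ) ∈ R)
    (hloc : ∀ c ∈ R, ∀ᶠ c' in 𝓝[(R : Set (Fin m → ℝ))] c, c' - (1 / 2 : ℝ) • c ∈ R)
    {B B' V V' : Fin n → Fin k → Set (Fin m → ℝ)}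
    (hV : ∀ i j, (V i j).Finite) (hV' : ∀ i j, (V' i j).Finite)
    (hVl : ∀ i j, V i j ⊆ latticePoints m) (hVl' : ∀ i j, V' i j ⊆ latticePoints m)
    (hne : ∀ j, ∃ i, (V i j).Nonempty) (hne' : ∀ j, ∃ i, (V' i j).Nonempty)
    (hB : ∀ i j, B i j = convexHull ℝ (V i j) + (R : Set (Fin m → ℝ)))
    (hB' : ∀ i j, B' i j = convexHull ℝ (V' i j) + (R : Set (Fin m → ℝ)))
    (hb : ∀ i j, Bornology.IsBounded (B i j \ B' i j))
    (hb' : ∀ i j, Bornology.IsBounded (B' i j \ B i j)) :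
    ∑ J : Finset (Fin k), (-1 : ℝ) ^ (k - J.card) *
        ∑ b ∈ Finset.piAntidiag (Finset.univ : Finset (Fin n)) J.card,
          (pairLatticeCount (decompositionJoin B J b, decompositionJoin B' J b) : ℝ) =
      ∑ J : Finset (Fin k), (-1 : ℝ) ^ (k - J.card) *
        pairVolume (∑ j ∈ J, cayley (fun i => B i j), ∑ j ∈ J, cayley (fun i => B' i j)) := by
  subst hk
  simp only [hB, hB'] at hb hb'
  have hv0 := mk_mem_verticalCone n h0
  have hbdd := isBounded_diff_dilatedSum_cayleyVertices hR h0 hloc hV hb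
  have hbdd' := isBounded_diff_dilatedSum_cayleyVertices hR h0 hloc hV' hb'
  have hconv : ∀ i j, Convex ℝ (B i j) := fun i j => by
    rw [hB]; exact (convex_convexHull ℝ _).add R.convex
  have hconv' : ∀ i j, Convex ℝ (B' i j) := fun i j => by
    rw [hB']; exact (convex_convexHull ℝ _).add R.convex
  have hU : ∀ j, (convexHull ℝ (cayleyVertices fun i => V i j)).Nonempty := fun j =>
    (nonempty_cayleyVertices (hne j)).convexHull
  have hU' : ∀ j, (convexHull ℝ (cayleyVertices fun i => V' i j)).Nonempty := fun j =>
    (nonempty_cayleyVertices (hne' j)).convexHull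
  have hhaar : (MeasureTheory.volume :
      MeasureTheory.Measure ((Fin (n - 1) → ℝ) × (Fin m → ℝ))).IsAddHaarMeasure :=
    MeasureTheory.Measure.prod.instIsAddHaarMeasure _ _
  have key := mixed_signedCount_eq_mixed_volume
    ((latticeSubgroup (n - 1)).prod (latticeSubgroup m))
    (fun S hS => finite_inter_prod_latticePoints hS)
    (fun S h1 h2 h3 => tendsto_ncard_smul_inter_div_pow S h1 h2 h3)
    (fun j => cayleyVertices fun i => V i j) (fun j => cayleyVertices fun i => V' i j)
    (fun j => finite_cayleyVertices fun i => hV i j)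
    (fun j => finite_cayleyVertices fun i => hV' i j)
    (fun j => nonempty_cayleyVertices (hne j)) (fun j => nonempty_cayleyVertices (hne' j))
    (fun j => cayleyVertices_subset fun i => hVl i j)
    (fun j => cayleyVertices_subset fun i => hVl' i j)
    (verticalCone n R) (isClosed_singleton.prod hR) (fun N => ⟨hbdd N, hbdd' N⟩)
  -- For `J = ∅` the two pairs differ, but each of them has equal components.
  have hpair : ∀ (J : Finset (Fin (n - 1 + m))) (T : Set _ × Set _ → ℝ), (∀ X, T (X, X) = 0) →
      T (∑ j ∈ J, cayley (fun i => B i j), ∑ j ∈ J, cayley (fun i => B' i j)) =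
      T (∑ j ∈ J, convexHull ℝ (cayleyVertices fun i => V i j) +
          (verticalCone n R : Set ((Fin (n - 1) → ℝ) × (Fin m → ℝ))),
        ∑ j ∈ J, convexHull ℝ (cayleyVertices fun i => V' i j) +
          (verticalCone n R : Set ((Fin (n - 1) → ℝ) × (Fin m → ℝ)))) := by
    intro J T hT
    rcases J.eq_empty_or_nonempty with rfl | hJ
    · simp only [Finset.sum_empty, hT]
    · simp only [hB, hB', cayley_convexHull_add]
      rw [sum_add_coe_convexCone hv0 hJ, sum_add_coe_convexCone hv0 hJ]
  have hbJ : ∀ J : Finset (Fin (n - 1 + m)),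
      Bornology.IsBounded ((∑ j ∈ J, cayley (fun i => B i j)) \
        (∑ j ∈ J, cayley (fun i => B' i j))) ∧
      Bornology.IsBounded ((∑ j ∈ J, cayley (fun i => B' i j)) \
        (∑ j ∈ J, cayley (fun i => B i j))) := by
    intro J
    rcases J.eq_empty_or_nonempty with rfl | hJ
    · simp
    · simp only [hB, hB', cayley_convexHull_add]
      rw [sum_add_coe_convexCone hv0 hJ, sum_add_coe_convexCone hv0 hJ,
        ← dilatedSum_ite hU, ← dilatedSum_ite hU']
      exact ⟨hbdd _, hbdd' _⟩
  rw [coe_prod_latticeSubgroup] at key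
  refine (Finset.sum_congr rfl fun J _ => ?_).trans (key.trans (Finset.sum_congr rfl fun J _ => ?_))
  · rw [← hpair J (fun A => ((signedCount (latticePoints (n - 1) ×ˢ latticePoints m) A : ℤ) : ℝ))
      fun X => by rw [signedCount_self, Int.cast_zero],
      signedCount_sum_cayley hn hconv hconv' J (hbJ J).1 (hbJ J).2]
    push_cast
    rfl
  · rw [hpair J pairVolume fun X => by simp [pairVolume]]

end Assembly

/-! ### Polytopes -/

section Polytopes

variable {n k m : ℕ}

theorem signedCount_eq_ncard_sub_ncard {E : Type*} {Λ X Y : Set E} (hX : (X ∩ Λ).Finite)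
    (hY : (Y ∩ Λ).Finite) :
    signedCount Λ (X, Y) = ((X ∩ Λ).ncard : ℤ) - ((Y ∩ Λ).ncard : ℤ) := by
  have h : ∀ A B : Set E, (A \ B) ∩ Λ = (A ∩ Λ) \ (B ∩ Λ) := by
    intro A B
    ext x
    simp only [Set.mem_inter_iff, Set.mem_sdiff]
    tauto
  have h1 := Set.ncard_sdiff_add_ncard (X ∩ Λ) (Y ∩ Λ) hX hY
  have h2 := Set.ncard_sdiff_add_ncard (Y ∩ Λ) (X ∩ Λ) hY hX
  rw [Set.union_comm] at h2
  rw [signedCount]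
  simp only [h]
  omega

theorem pairVolume_eq_sub {E : Type*} [MeasureTheory.MeasureSpace E] {X Y : Set E}
    (hX : MeasurableSet X) (hY : MeasurableSet Y) (hX' : MeasureTheory.volume X ≠ ⊤)
    (hY' : MeasureTheory.volume Y ≠ ⊤) :
    pairVolume (X, Y) = MeasureTheory.volume.real X - MeasureTheory.volume.real Y := by
  have h1 := MeasureTheory.measureReal_sdiff' (μ := MeasureTheory.volume) hY hX' hY'
  have h2 := MeasureTheory.measureReal_sdiff' (μ := MeasureTheory.volume) hX hY' hX'
  rw [Set.union_comm] at h2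
  rw [pairVolume, h1, h2]
  ring

theorem sum_finset_neg_one_pow_sub_card (hk : k ≠ 0) :
    ∑ J : Finset (Fin k), (-1 : ℝ) ^ (k - J.card) = 0 := by
  have h := Finset.sum_pow_mul_eq_add_pow (1 : ℝ) (-1) (Finset.univ : Finset (Fin k))
  simpa [hk] using h

/-- The identity between the lattice point counts and the volumes for lattice polytopes. It is
deduced from the case of pairs, the second components being chosen such that their Cayley
polytopes are the origin. -/
theorem sum_latticeCount_eq_sum_volume (hn : 1 ≤ n) (hk : k = n - 1 + m) (hk0 : k ≠ 0)
    {V : Fin n → Fin k → Set (Fin m → ℝ)} (hV : ∀ i j, (V i j).Finite)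
    (hVl : ∀ i j, V i j ⊆ latticePoints m) (hne : ∀ j, ∃ i, (V i j).Nonempty) :
    ∑ J : Finset (Fin k), (-1 : ℝ) ^ (k - J.card) *
        ∑ b ∈ Finset.piAntidiag (Finset.univ : Finset (Fin n)) J.card,
          (latticeCount (decompositionJoin (fun i j => convexHull ℝ (V i j)) J b) : ℝ) =
      ∑ J : Finset (Fin k), (-1 : ℝ) ^ (k - J.card) *
        MeasureTheory.volume.real (∑ j ∈ J, cayley (fun i => convexHull ℝ (V i j))) := by
  set B : Fin n → Fin k → Set (Fin m → ℝ) := fun i j => convexHull ℝ (V i j) with hB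
  let V' : Fin n → Fin k → Set (Fin m → ℝ) := fun i _ => if (i : ℕ) = n - 1 then {0} else ∅
  let B' : Fin n → Fin k → Set (Fin m → ℝ) := fun i j => convexHull ℝ (V' i j)
  have hV'f : ∀ i j, (V' i j).Finite := fun i j => by
    simp only [V']; split_ifs <;> simp
  have hlast : n - 1 < n := Nat.sub_lt hn one_pos
  have hcay : ∀ j, cayley (fun i => B' i j) = 0 := by
    intro j
    have : (⋃ i : Fin n, {simplexVertex i} ×ˢ B' i j) = {(0, 0)} := by
      ext ⟨p, y⟩
      simp only [Set.mem_iUnion, Set.mem_prod, Set.mem_singleton_iff, Prod.mk.injEq]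
      constructor
      · rintro ⟨i, rfl, hy⟩
        by_cases hi : (i : ℕ) = n - 1
        · refine ⟨?_, by simpa [B', V', hi] using hy⟩
          ext l
          have := l.2
          simp only [simplexVertex, Pi.zero_apply, ite_eq_right_iff, one_ne_zero]
          omega
        · simp [B', V', hi] at hy
      · rintro ⟨rfl, rfl⟩
        refine ⟨⟨n - 1, hlast⟩, ?_, by simp [B', V']⟩
        ext l
        have := l.2
        simp only [simplexVertex, Pi.zero_apply, right_eq_ite_iff, zero_ne_one]
        omega
    rw [cayley, this, convexHull_singleton]
    rfl
  have hsum : ∀ J : Finset (Fin k), ∑ j ∈ J, cayley (fun i => B' i j) = 0 := fun J => by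
    simp [hcay]
  have hcomp : ∀ J : Finset (Fin k), IsCompact (∑ j ∈ J, cayley (fun i => B i j)) := by
    refine fun J => isCompact_sum_set _ fun j _ => ?_
    have h := cayley_convexHull_add (fun i => V i j) (0 : ConvexCone ℝ (Fin m → ℝ))
    have h1 : ((verticalCone n (0 : ConvexCone ℝ (Fin m → ℝ)) :
        ConvexCone ℝ ((Fin (n - 1) → ℝ) × (Fin m → ℝ))) :
        Set ((Fin (n - 1) → ℝ) × (Fin m → ℝ))) = 0 :=
      Set.singleton_prod_singleton (a := (0 : Fin (n - 1) → ℝ)) (b := (0 : Fin m → ℝ))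
    rw [h1, ConvexCone.coe_zero] at h
    simp only [add_zero] at h
    rw [h]
    exact (finite_cayleyVertices fun i => hV i j).isCompact_convexHull ℝ
  have hbd : ∀ i j, Bornology.IsBounded (B i j) := fun i j =>
    ((hV i j).isCompact_convexHull ℝ).isBounded
  have hbd' : ∀ i j, Bornology.IsBounded (B' i j) := fun i j =>
    ((hV'f i j).isCompact_convexHull ℝ).isBounded
  have key := sum_pairLatticeCount_eq_sum_pairVolume (R := 0) (B := B) (B' := B') hn hk
    (by rw [ConvexCone.coe_zero]; exact isClosed_singleton) rfl
    (by
      intro c hc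
      obtain rfl : c = 0 := hc
      filter_upwards [self_mem_nhdsWithin] with x hx
      simpa using hx)
    hV hV'f hVl
    (fun i j => by
      simp only [V']
      split_ifs
      · exact Set.singleton_subset_iff.2 (latticeSubgroup m).zero_mem
      · exact Set.empty_subset _)
    hne (fun j => ⟨⟨n - 1, hlast⟩, 0, by simp [V']⟩)
    (fun i j => by rw [ConvexCone.coe_zero]; exact (add_zero _).symm)
    (fun i j => by rw [ConvexCone.coe_zero]; exact (add_zero _).symm)
    (fun i j => (hbd i j).subset Set.sdiff_subset)
    (fun i j => (hbd' i j).subset Set.sdiff_subset)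
  have hconv : ∀ i j, Convex ℝ (B i j) := fun i j => convex_convexHull ℝ _
  have hconv' : ∀ i j, Convex ℝ (B' i j) := fun i j => convex_convexHull ℝ _
  have hcount : ∀ J : Finset (Fin k),
      ∑ b ∈ Finset.piAntidiag (Finset.univ : Finset (Fin n)) J.card,
          (pairLatticeCount (decompositionJoin B J b, decompositionJoin B' J b) : ℝ) =
        ∑ b ∈ Finset.piAntidiag (Finset.univ : Finset (Fin n)) J.card,
          (latticeCount (decompositionJoin B J b) : ℝ) - 1 := by
    intro J
    have hb1 := (hcomp J).isBounded
    have hb2 : Bornology.IsBounded (∑ j ∈ J, cayley (fun i => B' i j)) := by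
      rw [hsum]; exact Bornology.isBounded_singleton
    have h1 := signedCount_sum_cayley hn hconv hconv' J (hb1.subset Set.sdiff_subset)
      (hb2.subset Set.sdiff_subset)
    have h2 := ncard_inter_eq_sum_latticeCount hn hconv subset_rfl
      (fun b hb y => mem_sum_cayley_iff hn hconv hb y) hb1
    have h3 : ((0 : Set ((Fin (n - 1) → ℝ) × (Fin m → ℝ))) ∩
        latticePoints (n - 1) ×ˢ latticePoints m).ncard = 1 := by
      have : (0 : Set ((Fin (n - 1) → ℝ) × (Fin m → ℝ))) ⊆
          latticePoints (n - 1) ×ˢ latticePoints m :=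
        Set.singleton_subset_iff.2
          ⟨(latticeSubgroup _).zero_mem, (latticeSubgroup _).zero_mem⟩
      rw [Set.inter_eq_left.2 this]
      exact Set.ncard_singleton _
    rw [signedCount_eq_ncard_sub_ncard (finite_inter_prod_latticePoints hb1)
      (finite_inter_prod_latticePoints hb2), h2, hsum, h3] at h1
    have := congrArg (Int.cast : ℤ → ℝ) h1
    push_cast at this
    exact this.symm
  have hvolume : ∀ J : Finset (Fin k),
      pairVolume (∑ j ∈ J, cayley (fun i => B i j), ∑ j ∈ J, cayley (fun i => B' i j)) =
        MeasureTheory.volume.real (∑ j ∈ J, cayley (fun i => B i j)) -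
        MeasureTheory.volume.real (0 : Set ((Fin (n - 1) → ℝ) × (Fin m → ℝ))) := by
    intro J
    rw [hsum]
    exact pairVolume_eq_sub (hcomp J).measurableSet (measurableSet_singleton _)
      (hcomp J).measure_ne_top isCompact_singleton.measure_ne_top
  simp only [hcount, hvolume, mul_sub, Finset.sum_sub_distrib, ← Finset.sum_mul,
    sum_finset_neg_one_pow_sub_card hk0, zero_mul, sub_zero] at key
  exact key

end Polytopes

/-! ### The identity for polyhedra -/

section Polyhedra

variable {n k m : ℕ}

theorem exists_eq_convexHull_of_isBounded {P : Set (Fin m → ℝ)} (hP : IsLatticePolyhedron P)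
    (hb : Bornology.IsBounded P) :
    ∃ V : Set (Fin m → ℝ), V.Finite ∧ V ⊆ latticePoints m ∧ P = convexHull ℝ V := by
  obtain ⟨⟨s, hs⟩, hl⟩ := hP
  rcases P.eq_empty_or_nonempty with rfl | ⟨x, hx⟩
  · exact ⟨∅, Set.finite_empty, Set.empty_subset _, by simp⟩
  have hs : P = polyhedron s := hs
  subst hs
  have hrec : ∀ a ∈ recessionCone s, a = 0 := fun a ha =>
    eq_zero_of_isBounded hb fun N =>
      add_smul_mem_of_vadd_subset ((vadd_polyhedron_subset_iff ⟨x, hx⟩ a).2 ha) hx N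
  have h0 : (recessionCone s : Set (Fin m → ℝ)) = 0 :=
    Set.eq_singleton_iff_unique_mem.2 ⟨zero_mem_recessionCone s, hrec⟩
  refine ⟨_, finite_extremePoints_polyhedron s, hl, ?_⟩
  conv_lhs => rw [polyhedron_eq_convexHull_add fun a ha _ => hrec a ha, h0, add_zero]

theorem exists_eq_convexHull_add_recessionCone {C : Set (Fin m → ℝ)}
    {s : Finset (((Fin m → ℝ) →ₗ[ℝ] ℝ) × ℝ)}
    (hs : ∀ a, a ∈ recessionCone s ↔ a +ᵥ C ⊆ C)
    (hline : ∀ a ∈ recessionCone s, -a ∈ recessionCone s → a = 0) {P : Set (Fin m → ℝ)}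
    (hP : IsLatticePolyhedron P) (hC : P = ∅ ∨ Parallel P C) :
    ∃ V : Set (Fin m → ℝ), V.Finite ∧ V ⊆ latticePoints m ∧
      P = convexHull ℝ V + (recessionCone s : Set (Fin m → ℝ)) := by
  rcases P.eq_empty_or_nonempty with rfl | hne
  · exact ⟨∅, Set.finite_empty, Set.empty_subset _, by simp⟩
  obtain ⟨⟨s', hs'⟩, hl⟩ := hP
  have hs' : P = polyhedron s' := hs'
  subst hs'
  have hpar : Parallel (polyhedron s') C := hC.resolve_left hne.ne_empty
  have hmem : ∀ a, a ∈ recessionCone s' ↔ a ∈ recessionCone s := fun a => by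
    rw [hs, ← vadd_polyhedron_subset_iff hne, hpar a]
  have heq : (recessionCone s' : Set (Fin m → ℝ)) = recessionCone s := Set.ext hmem
  refine ⟨_, finite_extremePoints_polyhedron s', hl, ?_⟩
  rw [← heq]
  exact polyhedron_eq_convexHull_add fun a ha ha' =>
    hline a ((hmem a).1 ha) ((hmem _).1 ha')

/-- A bounded pair of sets that are invariant under translations along a line is trivial. -/
theorem subset_of_isBounded_diff_of_line {P Q C : Set (Fin m → ℝ)} {a : Fin m → ℝ} (ha0 : a ≠ 0)
    (ha : a +ᵥ C ⊆ C) (ha' : -a +ᵥ C ⊆ C) (hP : P = ∅ ∨ Parallel P C) (hQ : Q = ∅ ∨ Parallel Q C)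
    (hb : Bornology.IsBounded (P \ Q)) : P ⊆ Q := by
  intro x hx
  by_contra hxQ
  have hP := hP.resolve_left fun h => by simp [h] at hx
  refine ha0 (eq_zero_of_isBounded hb (x := x) fun N =>
    ⟨add_smul_mem_of_vadd_subset ((hP a).2 ha) hx N, fun hN => hxQ ?_⟩)
  have hQ := hQ.resolve_left fun h => by simp [h] at hN
  simpa using add_smul_mem_of_vadd_subset ((hQ (-a)).2 ha') hN N

theorem pairMixedVolume_pairCayley (B : Fin n → Fin k → Set (Fin m → ℝ) × Set (Fin m → ℝ)) :
    pairMixedVolume (fun j => pairCayley fun i => B i j) =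
      (1 / (k.factorial : ℝ)) * ∑ J : Finset (Fin k), (-1 : ℝ) ^ (k - J.card) *
        pairVolume (∑ j ∈ J, cayley (fun i => (B i j).1), ∑ j ∈ J, cayley (fun i => (B i j).2)) := by
  have : ∀ J : Finset (Fin k), ∑ j ∈ J, pairCayley (fun i => B i j) =
      (∑ j ∈ J, cayley (fun i => (B i j).1), ∑ j ∈ J, cayley (fun i => (B i j).2)) := fun J =>
    Prod.ext (by simp [Prod.fst_sum, pairCayley]) (by simp [Prod.snd_sum, pairCayley])
  simp only [pairMixedVolume, this]

end Polyhedra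

theorem theorem4 (n k m : ℕ) (hn : 1 ≤ n) (hm : m + n = k + 1) :
    (∀ B : Fin n → Fin k → Set (Fin m → ℝ),
      (∀ i j, IsLatticePolyhedron (B i j) ∧ Bornology.IsBounded (B i j)) →
      (∀ j, ∃ i, (B i j).Nonempty) →
      mixedVolume (fun j => cayley fun i => B i j) =
        (1 / (k.factorial : ℝ)) * ∑ J : Finset (Fin k),
          ∑ b ∈ Finset.piAntidiag (Finset.univ : Finset (Fin n)) J.card,
            (-1 : ℝ) ^ (k - J.card) * (latticeCount (decompositionJoin B J b) : ℝ)) ∧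
    (∀ (C : ConvexCone ℝ (Fin m → ℝ))
      (B : Fin n → Fin k → Set (Fin m → ℝ) × Set (Fin m → ℝ)),
      (∀ i j, IsBoundedLatticePair C (B i j)) →
      (∀ j, (∃ i, (B i j).1.Nonempty) ∧ ∃ i, (B i j).2.Nonempty) →
      pairMixedVolume (fun j => pairCayley fun i => B i j) =
        (1 / (k.factorial : ℝ)) * ∑ J : Finset (Fin k),
          ∑ b ∈ Finset.piAntidiag (Finset.univ : Finset (Fin n)) J.card,
            (-1 : ℝ) ^ (k - J.card) * (pairLatticeCount (pairDecompositionJoin B J b) : ℝ)) := by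
  have hk : k = n - 1 + m := by omega
  refine ⟨fun B hB hne => ?_, fun C B hB hne => ?_⟩
  · rw [mixedVolume]
    congr 1
    simp only [← Finset.mul_sum]
    choose V hVf hVl hV using fun i j => exists_eq_convexHull_of_isBounded (hB i j).1 (hB i j).2
    have hne' : ∀ j, ∃ i, (V i j).Nonempty := fun j => by
      obtain ⟨i, hi⟩ := hne j
      rw [hV, convexHull_nonempty_iff] at hi
      exact ⟨i, hi⟩
    obtain rfl : B = fun i j => convexHull ℝ (V i j) := funext fun i => funext fun j => hV i j
    rcases eq_or_ne k 0 with rfl | hk0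
    · obtain rfl : n = 1 := by omega
      obtain rfl : m = 0 := by omega
      -- In dimension `0` both sides are the measure and the number of points of a single point.
      have hconv : ∀ i j, Convex ℝ (convexHull ℝ (V i j)) := fun i j => convex_convexHull ℝ _
      refine Finset.sum_congr rfl fun J _ => ?_
      obtain rfl : J = ∅ := Finset.eq_empty_of_isEmpty J
      have h := ncard_inter_eq_sum_latticeCount (J := ∅) hn hconv subset_rfl
        (fun b hb y => mem_sum_cayley_iff hn hconv hb y)
        (by rw [Finset.sum_empty]; exact Bornology.isBounded_singleton)
      have hl : (Set.univ : Set ((Fin (1 - 1) → ℝ) × (Fin 0 → ℝ))) =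
          latticePoints (1 - 1) ×ˢ latticePoints 0 :=
        (Set.eq_univ_of_forall fun _ => ⟨fun i => i.elim0, fun i => i.elim0⟩ :
          latticePoints (1 - 1) ×ˢ latticePoints 0 = Set.univ).symm
      have : IsEmpty (Fin (1 - 1)) := inferInstanceAs (IsEmpty (Fin 0))
      have h0 : (0 : Set ((Fin (1 - 1) → ℝ) × (Fin 0 → ℝ))) = Set.univ :=
        Set.eq_univ_of_forall fun x => Subsingleton.elim x 0
      have hv : MeasureTheory.volume.real (0 : Set ((Fin (1 - 1) → ℝ) × (Fin 0 → ℝ))) = 1 := by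
        rw [h0, ← Set.univ_prod_univ, MeasureTheory.Measure.volume_eq_prod,
          MeasureTheory.measureReal_prod_prod]
        simp [MeasureTheory.Measure.real, MeasureTheory.volume_pi]
      rw [Finset.sum_empty, ← hl, Set.inter_univ, show (0 : Set _).ncard = 1 from
        Set.ncard_singleton _] at h
      rw [Finset.sum_empty, hv]
      congr 1
      exact_mod_cast h
    · exact (sum_latticeCount_eq_sum_volume hn hk hk0 hVf hVl hne').symm
  · rw [pairMixedVolume_pairCayley]
    congr 1
    simp only [← Finset.mul_sum]
    by_cases htriv : ∀ i j, (B i j).1 = (B i j).2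
    · have h1 : ∀ (J : Finset (Fin k)) b, pairLatticeCount (pairDecompositionJoin B J b) = 0 :=
        fun J b => by
          rw [pairDecompositionJoin]
          simp only [htriv]
          exact signedCount_self _ _
      simp [h1, htriv, pairVolume]
    push Not at htriv
    obtain ⟨i₁, j₁, hij⟩ := htriv
    obtain ⟨i₀, hi₀⟩ := (hne j₁).1
    obtain ⟨s, hs⟩ := (hB i₀ j₁).lattice_fst.1
    have hs : (B i₀ j₁).1 = polyhedron s := hs
    have hpar := (hB i₀ j₁).parallel_fst.resolve_left hi₀.ne_empty
    rw [hs] at hi₀ hpar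
    have hsC : ∀ a, a ∈ recessionCone s ↔ a +ᵥ (C : Set (Fin m → ℝ)) ⊆ C := fun a => by
      rw [← vadd_polyhedron_subset_iff hi₀, hpar a]
    have hline : ∀ a ∈ recessionCone s, -a ∈ recessionCone s → a = 0 := by
      intro a ha ha'
      by_contra ha0
      rw [hsC] at ha ha'
      have h := hB i₁ j₁
      exact hij ((subset_of_isBounded_diff_of_line ha0 ha ha' h.parallel_fst h.parallel_snd
        h.bounded_fst).antisymm (subset_of_isBounded_diff_of_line ha0 ha ha' h.parallel_snd
        h.parallel_fst h.bounded_snd))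
    choose V hVf hVl hV using fun i j => exists_eq_convexHull_add_recessionCone hsC hline
      (hB i j).lattice_fst (hB i j).parallel_fst
    choose V' hVf' hVl' hV' using fun i j => exists_eq_convexHull_add_recessionCone hsC hline
      (hB i j).lattice_snd (hB i j).parallel_snd
    refine (sum_pairLatticeCount_eq_sum_pairVolume hn hk (isClosed_recessionCone s)
      (zero_mem_recessionCone s) (fun c hc => eventually_sub_half_smul_mem_recessionCone s hc)
      hVf hVf' hVl hVl' (fun j => ?_) (fun j => ?_) hV hV' (fun i j => (hB i j).bounded_fst)
      (fun i j => (hB i j).bounded_snd)).symm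
    · obtain ⟨i, hi⟩ := (hne j).1
      rw [hV] at hi
      exact ⟨i, convexHull_nonempty_iff.1 (Set.add_nonempty.1 hi).1⟩
    · obtain ⟨i, hi⟩ := (hne j).2
      rw [hV'] at hi
      exact ⟨i, convexHull_nonempty_iff.1 (Set.add_nonempty.1 hi).1⟩
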